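/- Let $\mathbb D$ be the open unit disc and, for $1\le p<\infty$, let $A^p$ be the Bergman space of all analytic functions $f$ on $\mathbb D$ with $\|f\|_{A^p}=\left(\int_{\mathbb D}|f|^p\,dA\right)^{1/p}<\infty$, where $dA=dx\,dy/\pi$. Let $\mu$ be a Borel probability measure on $[0,1)$, and let $$\Gamma_\mu(f)(z)=\int_{[0,1)} \frac{1}{1+(t-1)z}\, f\!\left(\frac{t}{1+(t-1)z}\right)d\mu(t),\qquad z\in\mathbb D .$$ We say that $\Gamma_\mu$ is well defined on $A^p$ if for every $f\in A^p$ this integral converges absolutely for every $z\in\mathbb D$ and $\Gamma_\mu(f)$ is analytic in $\mathbb D$. We say that $\Gamma_\mu$ is bounded on $A^p$ if it is well defined on $A^p$, maps $A^p$ into $A^p$, and $\|\Gamma_\mu(f)\|_{A^p}\le C\|f\|_{A^p}$ for all $f\in A^p$ and some finite constant $C$. Its norm is $\|\Gamma_\mu\|=\sup\{\|\Gamma_\mu(f)\|_{A^p}: f\in A^p,\ \|f\|_{A^p}=1\}\in[0,\infty]$, and $\|\Gamma_\mu\|=\infty$ if $\Gamma_\mu$ is not well defined on $A^p$. For $0\le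 t<1$ put $$\Theta_p(t)=\begin{cases}\dfrac{t^{2/p-1}}{(1-t)^{2/p}}, & 2<p<\infty,\\[2mm] \sqrt{\displaystyle\int_{[0,1)}\mu([0,s])\log\frac es\,d\mu(s)+\Big(\int_{[0,1)}\frac{1}{1-s}\,d\mu(s)\Big)^2}, & p=2,\\[2mm] \dfrac{1}{(1-t)^{2/p}}, & 1\le p<2,\end{cases}$$ where $[0,s]$ is the closed interval, $\log(e/0)=\infty$, $t^{2/p-1}=\infty$ if $t=0$ and $p>2$, and all integrals of nonnegative functions take values in $[0,\infty]$. Then, for every $1\le p<\infty$ and every such $\mu$, $\Gamma_\mu$ is bounded on $A^p$ if and only if $\int_{[0,1)}\Theta_p\,d\mu<\infty$. Moreover, there are positive finite constants $A(p),B(p)$, depending only on $p$, such that for every such $\mu$ $$A(p)\int_{[0,1)}\Theta_p\,d\mu\ \le\ \|\Gamma_\mu\|\ \le\ B(p)\int_{[0,1)}\Theta_p\,d\mu .$$ One can take $A(p)=1$ if $p>2$ and, in addition, $B(p)=1$ if $p\ge4$. Hence, if $p\ge 4$, $$\|\Gamma_\mu\|=\int_{[0,1)}\frac{t^{2/p-1}}{(1-t)^{2/p}}\,d\mu(t).$$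 -/

import Mathlib

open MeasureTheory
open scoped ENNReal

noncomputable section

namespace HilbertBergman

/-- The open unit disc of the complex plane. -/
def unitDisc : Set ℂ := Metric.ball (0 : ℂ) 1

/-- Normalized area measure `dA = dx dy / π` on the unit disc. -/
def areaDisc : Measure ℂ := (ENNReal.ofReal Real.pi)⁻¹ • (volume.restrict unitDisc)

/-- The Bergman norm `(∫_𝔻 |f|^p dA)^(1/p)`, with values in `[0, ∞]`. -/
def bergmanNorm (p : ℝ) (f : ℂ → ℂ) : ℝ≥0∞ := eLpNorm f (ENNReal.ofReal p) areaDisc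

/-- `f` belongs to the Bergman space `A^p`: it is analytic in the unit disc and its Bergman norm
is finite. Values of `f` off the disc play no role. -/
def MemBergman (p : ℝ) (f : ℂ → ℂ) : Prop :=
  AnalyticOnNhd ℂ f unitDisc ∧ bergmanNorm p f < ∞

/-- `φ_t(z) = t / (1 + (t - 1) z)`. -/
def phi (t : ℝ) (z : ℂ) : ℂ := (t : ℂ) / (1 + ((t : ℂ) - 1) * z)

/-- `w_t(z) = 1 / (1 + (t - 1) z)`. -/
def weight (t : ℝ) (z : ℂ) : ℂ := 1 / (1 + ((t : ℂ) - 1) * z)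

/-- The weighted composition operator `T_t f = w_t · (f ∘ φ_t)`. -/
def T (t : ℝ) (f : ℂ → ℂ) (z : ℂ) : ℂ := f (phi t z) * weight t z

/-- The generalized Hilbert operator `Γ_μ f (z) = ∫ T_t f (z) dμ(t)`. -/
def Gamma (μ : Measure ℝ) (f : ℂ → ℂ) (z : ℂ) : ℂ := ∫ t, T t f z ∂μ

/-- `Γ_μ` is well defined on `A^p`: for every `f ∈ A^p` the defining integral converges absolutely
at every point of the disc, and `Γ_μ f` is analytic in the disc. -/
def GammaDefined (μ : Measure ℝ) (p : ℝ) : Prop :=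
  ∀ f : ℂ → ℂ, MemBergman p f →
    (∀ z ∈ unitDisc, Integrable (fun t => T t f z) μ) ∧ AnalyticOnNhd ℂ (Gamma μ f) unitDisc

/-- `Γ_μ` is a bounded operator on `A^p`. -/
def GammaBounded (μ : Measure ℝ) (p : ℝ) : Prop :=
  GammaDefined μ p ∧ (∀ f : ℂ → ℂ, MemBergman p f → MemBergman p (Gamma μ f)) ∧
    ∃ C : ℝ, ∀ f : ℂ → ℂ, MemBergman p f →
      bergmanNorm p (Gamma μ f) ≤ ENNReal.ofReal C * bergmanNorm p f

open Classical in
/-- The operator norm `‖Γ_μ‖ = sup {‖Γ_μ f‖ : f ∈ A^p, ‖f‖ = 1}` with values in `[0, ∞]`; it is `∞`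
if `Γ_μ` is not well defined on `A^p`. -/
def gammaNorm (μ : Measure ℝ) (p : ℝ) : ℝ≥0∞ :=
  if GammaDefined μ p then
    ⨆ (f : ℂ → ℂ) (_ : MemBergman p f) (_ : bergmanNorm p f = 1), bergmanNorm p (Gamma μ f)
  else ∞

/-- `log (e / t)` for `0 ≤ t < 1`, with value `∞` at `t = 0`. -/
def logE (t : ℝ) : ℝ≥0∞ := if t = 0 then ∞ else ENNReal.ofReal (Real.log (Real.exp 1 / t))

/-- `t^(2/p - 1) / (1 - t)^(2/p)` for `0 ≤ t < 1`, computed in `[0, ∞]`;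
if `p > 2` its value at `t = 0` is `∞`. -/
def kernelTheta (p t : ℝ) : ℝ≥0∞ :=
  ENNReal.ofReal t ^ (2 / p - 1) / ENNReal.ofReal (1 - t) ^ (2 / p)

/-- The function `Θ_p`, which for `p = 2` is a constant that depends on `μ`. -/
def Theta (μ : Measure ℝ) (p t : ℝ) : ℝ≥0∞ :=
  if 2 < p then kernelTheta p t
  else if p = 2 then
    ((∫⁻ s, μ (Set.Icc 0 s) * logE s ∂μ) + (∫⁻ s, 1 / ENNReal.ofReal (1 - s) ∂μ) ^ 2)
      ^ (1 / 2 : ℝ)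
  else 1 / ENNReal.ofReal (1 - t) ^ (2 / p)

end HilbertBergman

end

noncomputable section

namespace HilbertBergman

open Filter Topology

/-! Write `Γ_μ f = ∫ T_t f dμ(t)` with `T_t f = w_t · (f ∘ φ_t)`. Two identities drive the upper
bound: `|φ_t| = t |w_t|` and `φ_t' = t (1 - t) w_t²`. Substituting `u = φ_t(z)` turns `|w_t|^p
dA(z)` into `t^(2-p) (1-t)^(-2) |u|^(p-4) dA(u)`, and the factor in `t` is the `p`-th power of
`kernelTheta p t`. By Minkowski's integral inequality it remains to control the weight `|u|^(p-4)`
(`exists_weighted_le`). For `p ≥ 4` it is at most `1`, which gives the constant `1`; for `2 < p < 4`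
it is integrable at the origin, where `f` is bounded by its norm.

For `p ≤ 2` this integrability fails. The substitution is then used only where `|φ_t| > 1/2`; where
`|φ_t| ≤ 1/2`, `f ∘ φ_t` is bounded by a multiple of the norm and the `L^p` norm of `∫ |w_t| dμ` is
left. If `p < 2`, the uniform bound `|w_t(z)| ≤ 4 / |1 - z|` suffices. If `p = 2` that bound just
fails to be in `L²`; expanding the square and estimating `∫ |w_t| |w_s| dA` by a multiple of `log (e
/ max(s, t))` produces the logarithmic energy.

The sharp lower bound comes from `f_a(z) = (1 - z)^(-a)`. These are approximate eigenfunctions: `T_t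
f_a = f_a · (1-t)^(-a) (den t)^(a-1)`, and `den t z` tends to `t` as `z → 1`. As `a` increases to
`2/p` their mass concentrates at `1`, and the eigenvalue tends to `kernelTheta p t`. All factors
have nonnegative real part, so nothing cancels in the `μ`-integral (`kernel_Ico_le_gammaNorm`). What
this misses near `t = 0` is recovered from the constant function `1`: it rules out an atom at `0`
when `p > 2`, gives norm at least `1`, and for `p = 2` bounds the logarithmic energy
(`logEnergy_le`). -/

/-- The common denominator `1 + (t - 1) z` of `phi` and `weight`. -/
def den (t : ℝ) (z : ℂ) : ℂ := 1 + ((t : ℂ) - 1) * z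

/-! ### Estimates for the denominator, the weight and the symbol -/

lemma den_eq (t : ℝ) (z : ℂ) : den t z = t + (1 - t) * (1 - z) := by
  unfold den; ring

lemma den_re (t : ℝ) (z : ℂ) : (den t z).re = t + (1 - t) * (1 - z.re) := by
  simp [den_eq]

lemma re_lt_one {z : ℂ} (hz : z ∈ unitDisc) : z.re < 1 := by
  have h1 : ‖z‖ < 1 := by simpa [unitDisc] using hz
  exact (Complex.re_le_norm z).trans_lt h1

lemma den_re_pos {t : ℝ} (ht : t ∈ Set.Ico (0 : ℝ) 1) {z : ℂ} (hz : z ∈ unitDisc) :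
    0 < (den t z).re := by
  rw [den_re]
  have := re_lt_one hz
  have := mul_pos (sub_pos.2 ht.2) (sub_pos.2 this)
  linarith [ht.1]

lemma den_ne_zero {t : ℝ} (ht : t ∈ Set.Ico (0 : ℝ) 1) {z : ℂ} (hz : z ∈ unitDisc) :
    den t z ≠ 0 := fun h => by
  have := den_re_pos ht hz
  simp [h] at this

lemma le_norm_den {t : ℝ} (ht : t ∈ Set.Ico (0 : ℝ) 1) {z : ℂ} (hz : z ∈ unitDisc) :
    t ≤ ‖den t z‖ := by
  refine le_trans ?_ (Complex.re_le_norm _)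
  rw [den_re]
  have := re_lt_one hz
  have := mul_pos (sub_pos.2 ht.2) (sub_pos.2 this)
  linarith [ht.1]

lemma norm_den_pos {t : ℝ} (ht : t ∈ Set.Ico (0 : ℝ) 1) {z : ℂ} (hz : z ∈ unitDisc) :
    0 < ‖den t z‖ := norm_pos_iff.2 (den_ne_zero ht hz)

lemma one_sub_mul_norm_le_norm_den {t : ℝ} (ht : t ∈ Set.Ico (0 : ℝ) 1) (z : ℂ) :
    1 - (1 - t) * ‖z‖ ≤ ‖den t z‖ := by
  have h : ‖(1 : ℂ)‖ - ‖(1 - (t : ℂ)) * z‖ ≤ ‖1 - (1 - (t : ℂ)) * z‖ := norm_sub_norm_le _ _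
  have e : den t z = 1 - (1 - (t : ℂ)) * z := by unfold den; ring
  have e2 : ‖(1 - (t : ℂ))‖ = 1 - t := by
    rw [← Complex.ofReal_one, ← Complex.ofReal_sub, Complex.norm_real, Real.norm_eq_abs,
      abs_of_pos (sub_pos.2 ht.2)]
  rw [e]
  simpa [e2] using h

lemma one_sub_norm_le_norm_den {t : ℝ} (ht : t ∈ Set.Ico (0 : ℝ) 1) (z : ℂ) :
    1 - ‖z‖ ≤ ‖den t z‖ := by
  refine le_trans ?_ (one_sub_mul_norm_le_norm_den ht z)
  nlinarith [norm_nonneg z, ht.1]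

lemma norm_one_sub_le_two {z : ℂ} (hz : z ∈ unitDisc) : ‖1 - z‖ < 2 := by
  have h1 : ‖z‖ < 1 := by simpa [unitDisc] using hz
  have := norm_sub_le (1 : ℂ) z
  rw [norm_one] at this
  linarith

/-- In `den t z = t + (1 - t)(1 - z)` both summands have nonnegative real part, so adding `t` cannot
decrease the modulus. -/
lemma one_sub_mul_norm_le {t : ℝ} (ht : t ∈ Set.Ico (0 : ℝ) 1) {z : ℂ} (hz : z ∈ unitDisc) :
    (1 - t) * ‖1 - z‖ ≤ ‖den t z‖ := by
  have hr := re_lt_one hz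
  have h1t := sub_pos.2 ht.2
  rw [← abs_of_nonneg (norm_nonneg (den t z)), ← abs_of_nonneg (mul_nonneg h1t.le (norm_nonneg _)),
    ← sq_le_sq, mul_pow, ← Complex.normSq_eq_norm_sq, ← Complex.normSq_eq_norm_sq,
    Complex.normSq_apply, Complex.normSq_apply, den_re]
  have : (den t z).im = - (1 - t) * z.im := by simp [den_eq]; ring
  rw [this]
  simp only [Complex.sub_re, Complex.one_re, Complex.sub_im, Complex.one_im]
  have := mul_nonneg ht.1 (mul_pos h1t (sub_pos.2 hr)).le
  nlinarith [ht.1]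

/-- Uniformity in `t` is the point. For `t ≤ 1/2` the term `(1 - t)(1 - z)` suffices; for `t ≥ 1/2`
one has `|den| ≥ 1/2` while `|1 - z| < 2`, whence the `4`. -/
lemma norm_one_sub_le_den {t : ℝ} (ht : t ∈ Set.Ico (0 : ℝ) 1) {z : ℂ} (hz : z ∈ unitDisc) :
    ‖1 - z‖ ≤ 4 * ‖den t z‖ := by
  rcases le_total t (1 / 2) with h | h
  · have := one_sub_mul_norm_le ht hz
    nlinarith [norm_nonneg (1 - z)]
  · have := le_norm_den ht hz
    have := norm_one_sub_le_two hz
    linarith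

lemma weight_eq (t : ℝ) (z : ℂ) : weight t z = (den t z)⁻¹ := by
  simp [weight, den]

lemma phi_eq (t : ℝ) (z : ℂ) : phi t z = t * (den t z)⁻¹ := by
  simp [phi, den, div_eq_mul_inv]

lemma one_sub_norm_phi {t : ℝ} (ht : t ∈ Set.Ico (0 : ℝ) 1) {z : ℂ} (hz : z ∈ unitDisc) :
    (1 - t) * (1 - ‖z‖) ≤ 1 - ‖phi t z‖ := by
  have h1 : ‖z‖ < 1 := by simpa [unitDisc] using hz
  have h2 := one_sub_mul_norm_le_norm_den ht z
  have h0 := norm_den_pos ht hz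
  have h1t := sub_pos.2 ht.2
  rw [phi_eq, norm_mul, norm_inv, Complex.norm_real, Real.norm_eq_abs, abs_of_nonneg ht.1,
    ← div_eq_mul_inv, le_sub_comm, div_le_iff₀ h0]
  -- The right side exceeds `t` by exactly `(1 - t)² ‖z‖ (1 - ‖z‖)`.
  have : t ≤ (1 - (1 - t) * (1 - ‖z‖)) * (1 - (1 - t) * ‖z‖) := by
    nlinarith [mul_nonneg (mul_nonneg h1t.le h1t.le) (mul_nonneg (norm_nonneg z) (sub_pos.2 h1).le)]
  refine this.trans (mul_le_mul_of_nonneg_left h2 ?_)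
  nlinarith [ht.1, norm_nonneg z]

lemma phi_mem {t : ℝ} (ht : t ∈ Set.Ico (0 : ℝ) 1) {z : ℂ} (hz : z ∈ unitDisc) :
    phi t z ∈ unitDisc := by
  have h1 : ‖z‖ < 1 := by simpa [unitDisc] using hz
  have := one_sub_norm_phi ht hz
  have := mul_pos (sub_pos.2 ht.2) (sub_pos.2 h1)
  simp only [unitDisc, Metric.mem_ball, dist_zero_right]
  linarith

lemma norm_weight_le_inv {t : ℝ} (ht : t ∈ Set.Ico (0 : ℝ) 1) {z : ℂ} (hz : z ∈ unitDisc) :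
    ‖weight t z‖ ≤ (1 - ‖z‖)⁻¹ := by
  have h1 : ‖z‖ < 1 := by simpa [unitDisc] using hz
  rw [weight_eq, norm_inv]
  exact inv_anti₀ (sub_pos.2 h1) (one_sub_norm_le_norm_den ht z)

lemma norm_weight_le_four_div {t : ℝ} (ht : t ∈ Set.Ico (0 : ℝ) 1) {z : ℂ} (hz : z ∈ unitDisc) :
    ‖weight t z‖ ≤ 4 * ‖1 - z‖⁻¹ := by
  have h1 : 0 < ‖1 - z‖ := lt_of_lt_of_le (by simpa using re_lt_one hz) (Complex.re_le_norm (1 - z))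
  rw [weight_eq, norm_inv, ← div_eq_mul_inv, inv_le_comm₀ (norm_den_pos ht hz) (by positivity),
    inv_div, div_le_iff₀ (by norm_num)]
  linarith [norm_one_sub_le_den ht hz]

lemma norm_weight_le_inv_self {t : ℝ} (ht : t ∈ Set.Ico (0 : ℝ) 1) (h0 : 0 < t)
    {z : ℂ} (hz : z ∈ unitDisc) : ‖weight t z‖ ≤ t⁻¹ := by
  rw [weight_eq, norm_inv]
  exact inv_anti₀ h0 (le_norm_den ht hz)

lemma measurable_den : Measurable (fun q : ℂ × ℝ => den q.2 q.1) := by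
  unfold den; fun_prop

lemma measurable_weight : Measurable (fun q : ℂ × ℝ => weight q.2 q.1) := by
  simp only [weight_eq]; exact measurable_den.inv

lemma measurable_phi : Measurable (fun q : ℂ × ℝ => phi q.2 q.1) := by
  simp only [phi_eq]
  exact (Complex.measurable_ofReal.comp measurable_snd).mul measurable_den.inv

/-! ### Normalized area and the Bergman norm -/

lemma isOpen_unitDisc : IsOpen unitDisc := Metric.isOpen_ball

lemma measurableSet_unitDisc : MeasurableSet unitDisc := isOpen_unitDisc.measurableSet

lemma ae_areaDisc_of_forall {P : ℂ → Prop} (h : ∀ z ∈ unitDisc, P z) : ∀ᵐ z ∂areaDisc, P z := by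
  refine Measure.ae_smul_measure ?_ _
  exact (ae_restrict_iff' measurableSet_unitDisc).2 (Filter.Eventually.of_forall h)

lemma lintegral_areaDisc (g : ℂ → ℝ≥0∞) :
    ∫⁻ z, g z ∂areaDisc = (ENNReal.ofReal Real.pi)⁻¹ * ∫⁻ z in unitDisc, g z := by
  simp [areaDisc]

lemma areaDisc_univ : areaDisc Set.univ = 1 := by
  have h : volume (unitDisc) = ENNReal.ofReal Real.pi := by
    rw [unitDisc, Complex.volume_ball]
    simp [ENNReal.ofReal, Real.toNNReal_of_nonneg Real.pi_pos.le]
    rfl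
  simp only [areaDisc, Measure.smul_apply, Measure.restrict_apply_univ, h, smul_eq_mul]
  exact ENNReal.inv_mul_cancel (by simpa using Real.pi_pos) ENNReal.ofReal_ne_top

instance : IsProbabilityMeasure areaDisc := ⟨areaDisc_univ⟩

lemma bergmanNorm_eq {p : ℝ} (hp : 1 ≤ p) (f : ℂ → ℂ) :
    bergmanNorm p f = (∫⁻ z, ‖f z‖ₑ ^ p ∂areaDisc) ^ (1 / p) := by
  have h0 : ENNReal.ofReal p ≠ 0 := by simpa using by linarith
  rw [bergmanNorm, eLpNorm_eq_lintegral_rpow_enorm_toReal h0 ENNReal.ofReal_ne_top,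
    ENNReal.toReal_ofReal (by linarith)]

lemma bergmanNorm_rpow {p : ℝ} (hp : 1 ≤ p) (f : ℂ → ℂ) :
    bergmanNorm p f ^ p = ∫⁻ z, ‖f z‖ₑ ^ p ∂areaDisc := by
  rw [bergmanNorm_eq hp, ← ENNReal.rpow_mul, one_div_mul_cancel (by linarith), ENNReal.rpow_one]

/-! ### Minkowski's integral inequality -/

/-- **Minkowski's integral inequality** over a finite measure space. -/
lemma lintegral_rpow_lintegral_le {α β : Type*} [MeasurableSpace α] [MeasurableSpace β]
    {μ : Measure α} {ν : Measure β} [IsFiniteMeasure μ] [SFinite ν] {p : ℝ} (hp : 1 ≤ p)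
    {F : α × β → ℝ≥0∞} (hF : Measurable F) :
    (∫⁻ z, (∫⁻ t, F (z, t) ∂ν) ^ p ∂μ) ^ (1 / p) ≤
      ∫⁻ t, (∫⁻ z, F (z, t) ^ p ∂μ) ^ (1 / p) ∂ν := by
  rcases hp.eq_or_lt with rfl | hp1
  · simp only [ENNReal.rpow_one, div_one]
    exact (lintegral_lintegral_swap (f := fun z t => F (z, t)) hF.aemeasurable).le
  have hp0 : 0 < p := by linarith
  set G : α → ℝ≥0∞ := fun z => ∫⁻ t, F (z, t) ∂ν with hG
  have hGm : Measurable G := hF.lintegral_prod_right'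
  set M := ∫⁻ t, (∫⁻ z, F (z, t) ^ p ∂μ) ^ (1 / p) ∂ν with hM
  have hpq := Real.HolderConjugate.conjExponent hp1
  set q := p.conjExponent with hq
  -- Truncating at `n` makes `A = ∫ H^p` finite. From `H^p ≤ G · H^(p-1)`, Tonelli and Hölder on
  -- each slice give `A ≤ M A^(1/q)`, and a finite nonzero `A^(1/q)` can be cancelled.
  have key : ∀ n : ℕ, ∫⁻ z, (min (G z) n) ^ p ∂μ ≤ M ^ p := by
    intro n
    set H : α → ℝ≥0∞ := fun z => min (G z) n with hH
    have hHm : Measurable H := hGm.min measurable_const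
    set A := ∫⁻ z, H z ^ p ∂μ with hA
    have hAfin : A ≠ ∞ := by
      refine ne_top_of_le_ne_top (b := ∫⁻ _, (n : ℝ≥0∞) ^ p ∂μ) ?_ (lintegral_mono fun z =>
        ENNReal.rpow_le_rpow (min_le_right _ _) hp0.le)
      rw [lintegral_const]
      exact ENNReal.mul_ne_top (ENNReal.rpow_ne_top_of_nonneg hp0.le (by simp)) (measure_ne_top _ _)
    have h1 : A ≤ M * A ^ (1 / q) := by
      calc A ≤ ∫⁻ z, G z * H z ^ (p - 1) ∂μ := by
            refine lintegral_mono fun z => ?_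
            have : H z ^ p = H z * H z ^ (p - 1) := by
              nth_rewrite 2 [← ENNReal.rpow_one (H z)]
              rw [← ENNReal.rpow_add_of_nonneg _ _ zero_le_one (by linarith)]; congr 1; ring
            rw [this]
            gcongr
            exact min_le_left _ _
        _ = ∫⁻ z, ∫⁻ t, F (z, t) * H z ^ (p - 1) ∂ν ∂μ := by
            refine lintegral_congr fun z => ?_
            exact (lintegral_mul_const _ (hF.comp measurable_prodMk_left)).symm
        _ = ∫⁻ t, ∫⁻ z, F (z, t) * H z ^ (p - 1) ∂μ ∂ν := by
            refine lintegral_lintegral_swap (f := fun z t => F (z, t) * H z ^ (p - 1))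
              (Measurable.aemeasurable ?_)
            exact hF.mul ((hHm.comp measurable_fst).pow_const _)
        _ ≤ ∫⁻ t, (∫⁻ z, F (z, t) ^ p ∂μ) ^ (1 / p) * A ^ (1 / q) ∂ν := by
            refine lintegral_mono fun t => ?_
            exact ENNReal.lintegral_mul_rpow_le_lintegral_rpow_mul_lintegral_rpow hpq
              (hF.comp measurable_prodMk_right).aemeasurable hHm.aemeasurable
        _ = M * A ^ (1 / q) := by
            rw [lintegral_mul_const]
            exact (Measurable.lintegral_prod_left' (hF.pow_const p)).pow_const _
    rcases eq_or_ne A 0 with h0 | h0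
    · rw [h0]; exact zero_le
    · have hpos : A ^ (1 / q) ≠ 0 := by
        simp [ENNReal.rpow_eq_zero_iff, h0, hAfin]
      have hfin : A ^ (1 / q) ≠ ∞ :=
        ENNReal.rpow_ne_top_of_nonneg (by have := hpq.symm.pos; positivity) hAfin
      have hsum : 1 / p + 1 / q = 1 := by simpa using hpq.inv_add_inv_eq_one
      have h2 : A = A ^ (1 / p) * A ^ (1 / q) := by
        rw [← ENNReal.rpow_add _ _ h0 hAfin, hsum, ENNReal.rpow_one]
      have h3 : A ^ (1 / p) ≤ M := by
        have h4 : A ^ (1 / p) * A ^ (1 / q) ≤ M * A ^ (1 / q) := h2 ▸ h1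
        exact (ENNReal.mul_le_mul_iff_left hpos hfin).1 h4
      calc A = (A ^ (1 / p)) ^ p := by
            rw [← ENNReal.rpow_mul, one_div_mul_cancel hp0.ne', ENNReal.rpow_one]
        _ ≤ M ^ p := ENNReal.rpow_le_rpow h3 hp0.le
  have hsup : ∀ z, G z ^ p = ⨆ n : ℕ, (min (G z) n) ^ p := by
    intro z
    refine le_antisymm ?_ (iSup_le fun n => ENNReal.rpow_le_rpow (min_le_left _ _) hp0.le)
    have hmono : Monotone fun n : ℕ => min (G z) (n : ℝ≥0∞) :=
      fun a b hab => min_le_min_left _ (by exact_mod_cast hab)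
    have ht : Filter.Tendsto (fun n : ℕ => min (G z) (n : ℝ≥0∞)) Filter.atTop
        (nhds (min (G z) ∞)) := tendsto_const_nhds.min ENNReal.tendsto_nat_nhds_top
    rw [min_eq_left le_top] at ht
    have h2 := (ENNReal.continuous_rpow_const (y := p)).tendsto _ |>.comp ht
    exact le_of_tendsto' h2 fun n => le_iSup (fun n : ℕ => (min (G z) (n : ℝ≥0∞)) ^ p) n
  have : ∫⁻ z, G z ^ p ∂μ ≤ M ^ p := by
    simp_rw [hsup]
    rw [lintegral_iSup]
    · exact iSup_le key
    · intro n; exact (hGm.min measurable_const).pow_const _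
    · intro a b hab z
      exact ENNReal.rpow_le_rpow (min_le_min_left _ (by exact_mod_cast hab)) hp0.le
  calc (∫⁻ z, G z ^ p ∂μ) ^ (1 / p) ≤ (M ^ p) ^ (1 / p) :=
        ENNReal.rpow_le_rpow this (by positivity)
    _ = M := by rw [← ENNReal.rpow_mul, mul_one_div_cancel hp0.ne', ENNReal.rpow_one]

/-! ### Polar coordinates, mean values and point evaluations -/

lemma lintegral_polar {g : ℂ → ℝ≥0∞} (hg : Measurable g) :
    ∫⁻ z, g z = ∫⁻ r in Set.Ioi (0 : ℝ), ENNReal.ofReal r *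
      ∫⁻ θ in Set.Ioo (-Real.pi) Real.pi, g (circleMap 0 r θ) := by
  rw [← Complex.lintegral_comp_polarCoord_symm, polarCoord_target, Measure.volume_eq_prod,
    ← Measure.prod_restrict, lintegral_prod]
  · refine lintegral_congr fun r => ?_
    rw [← lintegral_const_mul' _ _ ENNReal.ofReal_ne_top]
    refine lintegral_congr fun θ => ?_
    rw [Complex.polarCoord_symm_apply, smul_eq_mul, circleMap_zero, Complex.exp_mul_I,
      Complex.ofReal_cos, Complex.ofReal_sin]
  · refine Measurable.aemeasurable ?_
    refine (ENNReal.measurable_ofReal.comp measurable_fst).smul (hg.comp ?_)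
    rw [show ⇑Complex.polarCoord.symm = _ from funext Complex.polarCoord_symm_apply]
    fun_prop

lemma lintegral_norm_fun {g : ℝ → ℝ≥0∞} (hg : Measurable g) :
    ∫⁻ z : ℂ, g ‖z‖ = ENNReal.ofReal (2 * Real.pi) *
      ∫⁻ r in Set.Ioi (0 : ℝ), ENNReal.ofReal r * g r := by
  rw [lintegral_polar (g := fun z => g ‖z‖) (hg.comp measurable_norm),
    ← lintegral_const_mul' _ _ ENNReal.ofReal_ne_top]
  refine setLIntegral_congr_fun measurableSet_Ioi fun r hr => ?_
  simp only [norm_circleMap_zero, abs_of_pos (show 0 < r from hr), lintegral_const,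
    Measure.restrict_apply_univ, Real.volume_Ioo]
  rw [show Real.pi - -Real.pi = 2 * Real.pi by ring]
  ring

/-- Integrability of `|u|^q` near the origin of the plane for `q > -2`. -/
lemma lintegral_ball_norm_rpow_lt_top {q R : ℝ} (hq : -2 < q) :
    ∫⁻ u in Metric.ball (0 : ℂ) R, ENNReal.ofReal (‖u‖ ^ q) < ∞ := by
  rw [← lintegral_indicator measurableSet_ball]
  have e : ∀ u : ℂ, (Metric.ball (0 : ℂ) R).indicator (fun u => ENNReal.ofReal (‖u‖ ^ q)) u =
      (fun r : ℝ => (Set.Iio R).indicator (fun r => ENNReal.ofReal (r ^ q)) r) ‖u‖ := by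
    intro u
    by_cases h : ‖u‖ < R <;> simp [h]
  simp_rw [e]
  rw [lintegral_norm_fun (g := (Set.Iio R).indicator (fun r => ENNReal.ofReal (r ^ q)))
    (Measurable.indicator (ENNReal.measurable_ofReal.comp (measurable_id.pow_const q)) measurableSet_Iio)]
  refine ENNReal.mul_lt_top ENNReal.ofReal_lt_top ?_
  have h1 : IntegrableOn (fun r : ℝ => r ^ (q + 1)) (Set.Ioc 0 (max R 0)) := by
    have := intervalIntegral.intervalIntegrable_rpow' (a := 0) (b := max R 0) (r := q + 1)
      (by linarith)
    rwa [intervalIntegrable_iff_integrableOn_Ioc_of_le (le_max_right _ _)] at this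
  refine lt_of_le_of_lt ?_ h1.lintegral_lt_top
  rw [← lintegral_indicator measurableSet_Ioi, ← lintegral_indicator measurableSet_Ioc]
  refine lintegral_mono fun r => ?_
  by_cases hr : 0 < r
  · by_cases hR : r < R
    · have : r ≤ max R 0 := le_max_of_le_left hR.le
      simp only [Set.mem_Ioi, hr, Set.indicator_of_mem, Set.mem_Iio, hR, Set.mem_Ioc, this,
        and_self]
      rw [← ENNReal.ofReal_mul hr.le]
      refine le_of_eq ?_
      congr 1
      rw [Real.rpow_add hr, Real.rpow_one, mul_comm]
    · simp [Set.indicator_of_mem (Set.mem_Ioi.2 hr), Set.indicator_of_notMem (mt Set.mem_Iio.1 hR)]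
  · simp [hr]

lemma two_pi_mul_enorm_le {f : ℂ → ℂ} {c : ℂ} {r : ℝ} (hr : 0 < r)
    (hf : DifferentiableOn ℂ f (Metric.closedBall c r)) :
    ENNReal.ofReal (2 * Real.pi) * ‖f c‖ₑ ≤
      ∫⁻ θ in Set.Ioo (-Real.pi) Real.pi, ‖f (circleMap c r θ)‖ₑ := by
  have h1 : Real.circleAverage f c r = f c := by
    apply DiffContOnCl.circleAverage
    apply DifferentiableOn.diffContOnCl
    rwa [abs_of_pos hr, closure_ball c hr.ne']
  rw [Real.circleAverage] at h1
  have h2 : ∫ θ in (0 : ℝ)..2 * Real.pi, f (circleMap c r θ) =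
      ∫ θ in (-Real.pi)..Real.pi, f (circleMap c r θ) := by
    have hper : Function.Periodic (fun θ => f (circleMap c r θ)) (2 * Real.pi) := fun θ => by
      simp only [periodic_circleMap c r θ]
    have := hper.intervalIntegral_add_eq 0 (-Real.pi)
    rw [zero_add] at this
    rw [this]
    congr 1; ring
  have h3 : f c * (2 * Real.pi) = ∫ θ in (-Real.pi)..Real.pi, f (circleMap c r θ) := by
    rw [← h2, ← h1]
    have := Real.pi_ne_zero
    simp only [Complex.real_smul]
    push_cast
    field_simp
  have h4 : ENNReal.ofReal (2 * Real.pi) * ‖f c‖ₑ = ‖f c * (2 * Real.pi)‖ₑ := by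
    rw [enorm_mul, mul_comm]
    congr 1
    rw [← Complex.ofReal_ofNat, ← Complex.ofReal_mul, ← ofReal_norm, Complex.norm_real,
      Real.norm_of_nonneg (by positivity)]
  rw [h4, h3, intervalIntegral.integral_of_le (by linarith [Real.pi_pos]), integral_Ioc_eq_integral_Ioo]
  exact enorm_integral_le_lintegral_enorm _

lemma measurable_indicator_of_continuousOn {β : Type*} [TopologicalSpace β] [Zero β]
    [MeasurableSpace β] [BorelSpace β] {f : ℂ → β} {s : Set ℂ} (hf : ContinuousOn f s)
    (hs : MeasurableSet s) : Measurable (s.indicator f) := by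
  classical
  rw [← Set.piecewise_eq_indicator]
  exact hf.measurable_piecewise continuousOn_const hs

lemma lintegral_Ioo_ofReal {R : ℝ} (hR : 0 < R) :
    ∫⁻ r in Set.Ioo 0 R, ENNReal.ofReal r = ENNReal.ofReal (R ^ 2 / 2) := by
  have h : IntegrableOn (fun r : ℝ => r) (Set.Ioc 0 R) := by
    have := (continuous_id (X := ℝ)).intervalIntegrable 0 R (μ := volume)
    rwa [intervalIntegrable_iff_integrableOn_Ioc_of_le hR.le] at this
  rw [restrict_Ioo_eq_restrict_Ioc, ← ofReal_integral_eq_lintegral_ofReal h,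
    ← intervalIntegral.integral_of_le hR.le, integral_id]
  · simp
  · exact (ae_restrict_iff' measurableSet_Ioc).2 (Filter.Eventually.of_forall fun x hx => hx.1.le)

/-- The area sub-mean value property of the modulus of a holomorphic function. -/
lemma volume_ball_mul_enorm_le {f : ℂ → ℂ} {c : ℂ} {R : ℝ} (hR : 0 < R)
    (hf : DifferentiableOn ℂ f (Metric.ball c R)) :
    ENNReal.ofReal (Real.pi * R ^ 2) * ‖f c‖ₑ ≤ ∫⁻ z in Metric.ball c R, ‖f z‖ₑ := by
  have hm : Measurable ((Metric.ball c R).indicator fun z => ‖f z‖ₑ) :=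
    measurable_indicator_of_continuousOn (continuous_enorm.comp_continuousOn hf.continuousOn)
      measurableSet_ball
  rw [← lintegral_indicator measurableSet_ball, ← lintegral_add_left_eq_self _ c,
    lintegral_polar (g := fun z => (Metric.ball c R).indicator (fun z => ‖f z‖ₑ) (c + z))
      (hm.comp (measurable_const_add c))]
  calc ENNReal.ofReal (Real.pi * R ^ 2) * ‖f c‖ₑ
      = ∫⁻ r in Set.Ioo 0 R, ENNReal.ofReal r * (ENNReal.ofReal (2 * Real.pi) * ‖f c‖ₑ) := by
        rw [lintegral_mul_const _ ENNReal.measurable_ofReal, lintegral_Ioo_ofReal hR, ← mul_assoc,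
          ← ENNReal.ofReal_mul (by positivity)]
        congr 2; ring
    _ ≤ ∫⁻ r in Set.Ioo 0 R, ENNReal.ofReal r * ∫⁻ θ in Set.Ioo (-Real.pi) Real.pi,
          (Metric.ball c R).indicator (fun z => ‖f z‖ₑ) (c + circleMap 0 r θ) := by
        refine setLIntegral_mono' measurableSet_Ioo fun r hr => ?_
        gcongr
        refine (two_pi_mul_enorm_le hr.1
          (hf.mono (Metric.closedBall_subset_ball hr.2))).trans_eq ?_
        refine lintegral_congr fun θ => ?_
        have e : c + circleMap 0 r θ = circleMap c r θ := by simp [circleMap]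
        rw [e, Set.indicator_of_mem]
        rw [Metric.mem_ball, dist_eq_norm, circleMap_sub_center, norm_circleMap_zero,
          abs_of_pos hr.1]
        exact hr.2
    _ ≤ _ := lintegral_mono_set Set.Ioo_subset_Ioi_self

lemma volume_ball_eq (c : ℂ) (R : ℝ) :
    volume (Metric.ball c R) = ENNReal.ofReal Real.pi * ENNReal.ofReal R ^ 2 := by
  rw [Complex.volume_ball, mul_comm]
  congr 1
  simp [ENNReal.ofReal, Real.toNNReal_of_nonneg Real.pi_pos.le]
  rfl

/-- Point evaluations are bounded on the Bergman space. -/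
lemma enorm_le_bergmanNorm {p : ℝ} (hp : 1 ≤ p) {f : ℂ → ℂ} (hf : AnalyticOnNhd ℂ f unitDisc)
    {z : ℂ} (hz : z ∈ unitDisc) :
    ‖f z‖ₑ ≤ ENNReal.ofReal (1 - ‖z‖) ^ (-(2 / p)) * bergmanNorm p f := by
  have h1 : ‖z‖ < 1 := by simpa [unitDisc] using hz
  set R := 1 - ‖z‖ with hRdef
  have hR : 0 < R := sub_pos.2 h1
  have hsub : Metric.ball z R ⊆ unitDisc := by
    refine Metric.ball_subset_ball' ?_
    simp [hRdef]
  have hd : DifferentiableOn ℂ f (Metric.ball z R) := hf.differentiableOn.mono hsub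
  set V := ENNReal.ofReal Real.pi * ENNReal.ofReal R ^ 2 with hV
  have hpi0 : ENNReal.ofReal Real.pi ≠ 0 := by simpa using Real.pi_pos
  have hR0 : ENNReal.ofReal R ≠ 0 := by simpa using hR
  have hV0 : V ≠ 0 := by simp [hV, hpi0, hR]
  have hVt : V ≠ ∞ := by
    refine ENNReal.mul_ne_top ENNReal.ofReal_ne_top ?_
    exact ENNReal.pow_ne_top ENNReal.ofReal_ne_top
  -- Normalized area on the largest disc about `z` inside the unit disc. The sub-mean value property
  -- bounds `|f z|` by the `L¹(ν)` norm, hence by the `L^p(ν)` norm since `ν` is a probability, and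
  -- `ν ≤ R⁻² dA` gives the exponent `-2/p`.
  set ν : Measure ℂ := V⁻¹ • volume.restrict (Metric.ball z R) with hν
  have hprob : IsProbabilityMeasure ν := ⟨by
    simp only [hν, Measure.smul_apply, Measure.restrict_apply_univ, volume_ball_eq z R, smul_eq_mul]
    exact ENNReal.inv_mul_cancel hV0 hVt⟩
  have hle : ν ≤ (ENNReal.ofReal R ^ 2)⁻¹ • areaDisc := by
    have e : (ENNReal.ofReal R ^ 2)⁻¹ • areaDisc = V⁻¹ • volume.restrict unitDisc := by
      rw [areaDisc, smul_smul, hV, ENNReal.mul_inv (Or.inl hpi0) (Or.inl ENNReal.ofReal_ne_top),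
        mul_comm]
    rw [e]
    refine Measure.le_intro fun s _ _ => ?_
    simp only [Measure.smul_apply, smul_eq_mul]
    exact mul_le_mul' le_rfl (Measure.restrict_mono hsub le_rfl _)
  have hmeas : AEStronglyMeasurable f ν :=
    (hd.continuousOn.aestronglyMeasurable measurableSet_ball).smul_measure _
  have hp1 : (1 : ℝ≥0∞) ≤ ENNReal.ofReal p := by simpa using hp
  calc ‖f z‖ₑ ≤ eLpNorm f 1 ν := by
        rw [eLpNorm_one_eq_lintegral_enorm, hν, lintegral_smul_measure, smul_eq_mul]
        have := volume_ball_mul_enorm_le hR hd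
        rw [ENNReal.ofReal_mul Real.pi_pos.le, ENNReal.ofReal_pow hR.le] at this
        calc ‖f z‖ₑ = V⁻¹ * (V * ‖f z‖ₑ) := by
              rw [← mul_assoc, ENNReal.inv_mul_cancel hV0 hVt, one_mul]
          _ ≤ _ := by gcongr
    _ ≤ eLpNorm f (ENNReal.ofReal p) ν := eLpNorm_le_eLpNorm_of_exponent_le hp1 hmeas
    _ ≤ eLpNorm f (ENNReal.ofReal p) ((ENNReal.ofReal R ^ 2)⁻¹ • areaDisc) :=
        eLpNorm_mono_measure _ hle
    _ = _ := by
        rw [eLpNorm_smul_measure_of_ne_top ENNReal.ofReal_ne_top, bergmanNorm, smul_eq_mul,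
          ENNReal.toReal_div, ENNReal.toReal_ofReal (by linarith)]
        congr 1
        rw [← ENNReal.rpow_natCast, ← ENNReal.rpow_neg, ← ENNReal.rpow_mul]
        congr 1
        simp
        ring

/-! ### The change of variables `u = φ_t(z)` -/

lemma hasDerivAt_den (t : ℝ) (z : ℂ) : HasDerivAt (den t) ((t : ℂ) - 1) z := by
  unfold den
  simpa using ((hasDerivAt_id z).const_mul ((t : ℂ) - 1)).const_add 1

lemma hasDerivAt_phi {t : ℝ} (ht : t ∈ Set.Ico (0 : ℝ) 1) {z : ℂ} (hz : z ∈ unitDisc) :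
    HasDerivAt (phi t) (t * (1 - t) * weight t z ^ 2) z := by
  have h := ((hasDerivAt_den t z).inv (den_ne_zero ht hz)).const_mul (t : ℂ)
  have e : phi t = fun z => (t : ℂ) * (den t)⁻¹ z := funext fun z => by simp [phi_eq]
  rw [e]
  refine h.congr_deriv ?_
  rw [weight_eq]
  field_simp
  ring

lemma injOn_phi {t : ℝ} (ht : t ∈ Set.Ioo (0 : ℝ) 1) : Set.InjOn (phi t) unitDisc := by
  intro x _ y _ h
  have h0 : (t : ℂ) ≠ 0 := by exact_mod_cast ht.1.ne'
  have h1 : (t : ℂ) - 1 ≠ 0 := by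
    rw [← Complex.ofReal_one, ← Complex.ofReal_sub]
    exact_mod_cast (sub_neg.2 ht.2).ne
  rw [phi_eq, phi_eq, mul_right_inj' h0, inv_inj, den, den, add_right_inj, mul_right_inj' h1] at h
  exact h

/-- The real determinant of multiplication by `w` is the field norm of `w` from `ℂ` to `ℝ`. -/
lemma abs_det_smulRight (w : ℂ) :
    |(((1 : ℂ →L[ℂ] ℂ).smulRight w).restrictScalars ℝ).det| = ‖w‖ ^ 2 := by
  have e : (((1 : ℂ →L[ℂ] ℂ).smulRight w).restrictScalars ℝ : ℂ →ₗ[ℝ] ℂ) =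
      LinearMap.mul ℝ ℂ w := by
    ext z; simp [mul_comm]
  have : (((1 : ℂ →L[ℂ] ℂ).smulRight w).restrictScalars ℝ).det = Algebra.norm ℝ w := by
    rw [Algebra.norm_apply]
    exact congrArg LinearMap.det e
  rw [this, Algebra.norm_complex_apply, Complex.normSq_eq_norm_sq, abs_of_nonneg (sq_nonneg _)]

/-- The change of variables `u = φ_t(z)`. -/
lemma lintegral_comp_phi_mul_weight (p : ℝ) {t : ℝ} (ht : t ∈ Set.Ioo (0 : ℝ) 1)
    (g : ℂ → ℝ≥0∞) :
    ∫⁻ z in unitDisc, g (phi t z) * ‖weight t z‖ₑ ^ p =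
      ENNReal.ofReal (t ^ (2 - p) * (1 - t) ^ (-2 : ℝ)) *
        ∫⁻ u in phi t '' unitDisc, ‖u‖ₑ ^ (p - 4) * g u := by
  have ht' : t ∈ Set.Ico (0 : ℝ) 1 := ⟨ht.1.le, ht.2⟩
  rw [lintegral_image_eq_lintegral_abs_det_fderiv_mul volume measurableSet_unitDisc
    (fun z hz => ((hasDerivAt_phi ht' hz).hasFDerivAt.restrictScalars ℝ).hasFDerivWithinAt)
    (injOn_phi ht), ← lintegral_const_mul' _ _ ENNReal.ofReal_ne_top]
  refine setLIntegral_congr_fun measurableSet_unitDisc fun z hz => ?_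
  have hd := norm_den_pos ht' hz
  have hw : 0 < ‖weight t z‖ := by rw [weight_eq, norm_inv]; positivity
  have h1t : 0 < 1 - t := sub_pos.2 ht.2
  -- This trades powers of the weight for powers of `|u|`, which is how `|u|^(p-4)` arises.
  have hφ : ‖phi t z‖ = t * ‖weight t z‖ := by
    rw [phi_eq, weight_eq, norm_mul, Complex.norm_real, Real.norm_of_nonneg ht.1.le]
  have hφ0 : 0 < ‖phi t z‖ := by rw [hφ]; exact mul_pos ht.1 hw
  have hdet : |(ContinuousLinearMap.restrictScalars ℝ
      (ContinuousLinearMap.toSpanSingleton ℂ ((t : ℂ) * (1 - t) * weight t z ^ 2))).det| =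
      (t * (1 - t) * ‖weight t z‖ ^ 2) ^ 2 := by
    have := abs_det_smulRight ((t : ℂ) * (1 - t) * weight t z ^ 2)
    rw [ContinuousLinearMap.smulRight_one_eq_toSpanSingleton] at this
    rw [this, norm_mul, norm_mul, norm_pow, Complex.norm_real, Real.norm_of_nonneg ht.1.le]
    congr 3
    rw [← Complex.ofReal_one, ← Complex.ofReal_sub, Complex.norm_real, Real.norm_of_nonneg h1t.le]
  have h0 := ht.1
  simp only [hdet]
  rw [← ofReal_norm (weight t z), ← ofReal_norm (phi t z), ENNReal.ofReal_rpow_of_pos hw,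
    ENNReal.ofReal_rpow_of_pos hφ0, ← mul_assoc, ← mul_assoc, ← ENNReal.ofReal_mul (by positivity),
    ← ENNReal.ofReal_mul (by positivity), mul_comm]
  congr 2
  rw [hφ, Real.mul_rpow h0.le hw.le, Real.rpow_sub h0, Real.rpow_sub h0, Real.rpow_sub hw,
    Real.rpow_neg h1t.le]
  have hp := Real.rpow_pos_of_pos h0 p
  have e1 : t ^ (4 : ℝ) = t ^ 4 := by exact_mod_cast Real.rpow_natCast t 4
  have e2 : ‖weight t z‖ ^ (4 : ℝ) = ‖weight t z‖ ^ 4 := by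
    exact_mod_cast Real.rpow_natCast ‖weight t z‖ 4
  rw [e1, e2, Real.rpow_two, Real.rpow_two]
  field_simp

lemma kernelTheta_eq {p t : ℝ} (ht : t ∈ Set.Ioo (0 : ℝ) 1) :
    kernelTheta p t = ENNReal.ofReal (t ^ (2 / p - 1) / (1 - t) ^ (2 / p)) := by
  have h1t : 0 < 1 - t := sub_pos.2 ht.2
  rw [kernelTheta, ENNReal.ofReal_rpow_of_pos ht.1, ENNReal.ofReal_rpow_of_pos h1t,
    ENNReal.ofReal_div_of_pos (by positivity)]

/-- Identifies the Jacobian constant of the substitution as the `p`-th power of the kernel in the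
theorem. -/
lemma kernelTheta_rpow {p t : ℝ} (hp : 1 ≤ p) (ht : t ∈ Set.Ioo (0 : ℝ) 1) :
    kernelTheta p t ^ p = ENNReal.ofReal (t ^ (2 - p) * (1 - t) ^ (-2 : ℝ)) := by
  have h1t : 0 < 1 - t := sub_pos.2 ht.2
  have h0 := ht.1
  have hp0 : p ≠ 0 := by positivity
  rw [kernelTheta_eq ht, ENNReal.ofReal_rpow_of_pos (by positivity),
    Real.div_rpow (by positivity) (by positivity), ← Real.rpow_mul h0.le, ← Real.rpow_mul h1t.le,
    Real.rpow_neg h1t.le, div_eq_mul_inv]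
  congr 3
  · field_simp
  · congr 1; field_simp

lemma measurable_kernelTheta (p : ℝ) : Measurable (kernelTheta p) := by
  unfold kernelTheta
  fun_prop

/-- The substitution, with the image of `φ_t` enlarged to the whole disc. -/
lemma lintegral_areaDisc_comp_phi_le {p : ℝ} (hp : 1 ≤ p) {t : ℝ} (ht : t ∈ Set.Ioo (0 : ℝ) 1)
    (g : ℂ → ℝ≥0∞) :
    ∫⁻ z, g (phi t z) * ‖weight t z‖ₑ ^ p ∂areaDisc ≤
      kernelTheta p t ^ p * ∫⁻ u, ‖u‖ₑ ^ (p - 4) * g u ∂areaDisc := by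
  rw [lintegral_areaDisc, lintegral_areaDisc, lintegral_comp_phi_mul_weight p ht,
    kernelTheta_rpow hp ht, mul_left_comm]
  gcongr
  rintro _ ⟨z, hz, rfl⟩
  exact phi_mem ⟨ht.1.le, ht.2⟩ hz

/-! ### Upper bound for `p > 2` -/

lemma lintegral_areaDisc_one_sub_le (h : ℝ → ℝ≥0∞) :
    ∫⁻ z, h ‖1 - z‖ ∂areaDisc ≤
      (ENNReal.ofReal Real.pi)⁻¹ * ∫⁻ u in Metric.ball (0 : ℂ) 2, h ‖u‖ := by
  rw [lintegral_areaDisc]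
  refine mul_le_mul' le_rfl ?_
  rw [← lintegral_indicator measurableSet_ball, ← lintegral_indicator measurableSet_unitDisc,
    ← lintegral_sub_left_eq_self _ (1 : ℂ)]
  refine lintegral_mono fun z => ?_
  by_cases hz : 1 - z ∈ unitDisc
  · have : z ∈ Metric.ball (0 : ℂ) 2 := by
      have := norm_one_sub_le_two hz
      rw [sub_sub_cancel] at this
      simpa using this
    rw [Set.indicator_of_mem hz, Set.indicator_of_mem this, sub_sub_cancel]
  · rw [Set.indicator_of_notMem hz]
    exact zero_le

lemma lintegral_areaDisc_one_sub_rpow_lt_top {q : ℝ} (hq : -2 < q) :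
    ∫⁻ z, ENNReal.ofReal (‖1 - z‖ ^ q) ∂areaDisc < ∞ := by
  refine (lintegral_areaDisc_one_sub_le fun r => ENNReal.ofReal (r ^ q)).trans_lt ?_
  refine ENNReal.mul_lt_top ?_ (lintegral_ball_norm_rpow_lt_top hq)
  simpa using Real.pi_pos

/-- Values of `f` off the disc are arbitrary, so joint measurability is available only after cutting
`f` off to a set on which it is continuous. -/
lemma measurable_T_bound {S : Set ℂ} {f : ℂ → ℂ} (hS : MeasurableSet S)
    (hf : ContinuousOn f S) :
    Measurable fun q : ℂ × ℝ => ‖S.indicator f (phi q.2 q.1)‖ₑ * ‖weight q.2 q.1‖ₑ :=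
  ((measurable_indicator_of_continuousOn hf hS).comp measurable_phi).enorm.mul
    measurable_weight.enorm

lemma enorm_T_eq {f : ℂ → ℂ} {t : ℝ} (ht : t ∈ Set.Ico (0 : ℝ) 1) {z : ℂ} (hz : z ∈ unitDisc) :
    ‖T t f z‖ₑ = ‖unitDisc.indicator f (phi t z)‖ₑ * ‖weight t z‖ₑ := by
  rw [T, enorm_mul, Set.indicator_of_mem (phi_mem ht hz)]

lemma ae_mem_Ico {μ : Measure ℝ} (hμ : μ (Set.Ico (0 : ℝ) 1)ᶜ = 0) :
    ∀ᵐ t ∂μ, t ∈ Set.Ico (0 : ℝ) 1 := by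
  rw [ae_iff]; exact hμ

lemma bergmanNorm_Gamma_le {p : ℝ} (hp : 1 ≤ p) {μ : Measure ℝ}
    (hμ : μ (Set.Ico (0 : ℝ) 1)ᶜ = 0) {f : ℂ → ℂ} {F : ℂ × ℝ → ℝ≥0∞}
    (hF : ∀ t ∈ Set.Ico (0 : ℝ) 1, ∀ z ∈ unitDisc, ‖T t f z‖ₑ ≤ F (z, t)) :
    bergmanNorm p (Gamma μ f) ≤ (∫⁻ z, (∫⁻ t, F (z, t) ∂μ) ^ p ∂areaDisc) ^ (1 / p) := by
  rw [bergmanNorm_eq hp]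
  refine ENNReal.rpow_le_rpow (lintegral_mono_ae (ae_areaDisc_of_forall fun z hz => ?_))
    (by positivity)
  refine ENNReal.rpow_le_rpow ?_ (by positivity)
  refine (enorm_integral_le_lintegral_enorm _).trans (lintegral_mono_ae ?_)
  filter_upwards [ae_mem_Ico hμ] with t ht using hF t ht z hz

lemma rpow_one_div_le {p : ℝ} (hp : 1 ≤ p) {a b c x : ℝ≥0∞} (h : x ≤ a ^ p * (b * c ^ p)) :
    x ^ (1 / p) ≤ a * (b ^ (1 / p) * c) := by
  have hp0 : 0 < p := by linarith
  refine (ENNReal.rpow_le_rpow h (by positivity : 0 ≤ 1 / p)).trans_eq ?_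
  rw [ENNReal.mul_rpow_of_nonneg _ _ (by positivity), ENNReal.mul_rpow_of_nonneg _ _ (by positivity),
    ← ENNReal.rpow_mul, ← ENNReal.rpow_mul, mul_one_div_cancel hp0.ne', ENNReal.rpow_one,
    ENNReal.rpow_one]

/-- The transfer of a weighted norm estimate for `f` to a norm estimate for `T_t f`. -/
lemma lintegral_T_bound_le {p : ℝ} (hp : 1 ≤ p) {S : Set ℂ} {f : ℂ → ℂ} {C N : ℝ≥0∞}
    (hC : ∫⁻ u, ‖u‖ₑ ^ (p - 4) * ‖S.indicator f u‖ₑ ^ p ∂areaDisc ≤ C * N ^ p)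
    {t : ℝ} (ht : t ∈ Set.Ioo (0 : ℝ) 1) :
    (∫⁻ z, (‖S.indicator f (phi t z)‖ₑ * ‖weight t z‖ₑ) ^ p ∂areaDisc) ^ (1 / p) ≤
      kernelTheta p t * (C ^ (1 / p) * N) := by
  refine rpow_one_div_le hp ?_
  simp_rw [ENNReal.mul_rpow_of_nonneg _ _ (show 0 ≤ p by linarith)]
  refine (lintegral_areaDisc_comp_phi_le hp ht fun u => ‖S.indicator f u‖ₑ ^ p).trans ?_
  gcongr

lemma enorm_rpow_le_one {u : ℂ} (hu : u ∈ unitDisc) {q : ℝ} (hq : 0 ≤ q) : ‖u‖ₑ ^ q ≤ 1 := by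
  refine ENNReal.rpow_le_one ?_ hq
  have h1 : ‖u‖ < 1 := by simpa [unitDisc] using hu
  rw [← ofReal_norm, ← ENNReal.ofReal_one]
  exact ENNReal.ofReal_le_ofReal h1.le

lemma weighted_le_of_four_le {p : ℝ} (hp : 4 ≤ p) (f : ℂ → ℂ) :
    ∫⁻ u, ‖u‖ₑ ^ (p - 4) * ‖unitDisc.indicator f u‖ₑ ^ p ∂areaDisc ≤ 1 * bergmanNorm p f ^ p := by
  rw [bergmanNorm_rpow (by linarith), one_mul]
  refine lintegral_mono_ae (ae_areaDisc_of_forall fun u hu => ?_)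
  rw [Set.indicator_of_mem hu]
  exact mul_le_of_le_one_left' (enorm_rpow_le_one hu (by linarith))

/-- A bound for `|f|` on the disc of radius `1 / 2`. -/
lemma enorm_le_of_norm_le_half {p : ℝ} (hp : 1 ≤ p) {f : ℂ → ℂ} (hf : AnalyticOnNhd ℂ f unitDisc)
    {u : ℂ} (hu : ‖u‖ ≤ 1 / 2) : ‖f u‖ₑ ≤ 2 ^ (2 / p) * bergmanNorm p f := by
  have hu' : u ∈ unitDisc := by simp [unitDisc]; linarith
  refine (enorm_le_bergmanNorm hp hf hu').trans ?_
  gcongr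
  rw [ENNReal.rpow_neg, ← ENNReal.inv_rpow]
  refine ENNReal.rpow_le_rpow ?_ (by positivity)
  rw [ENNReal.inv_le_iff_inv_le, ← ENNReal.ofReal_ofNat, ← ENNReal.ofReal_inv_of_pos (by norm_num)]
  exact ENNReal.ofReal_le_ofReal (by norm_num at hu ⊢; linarith)

lemma enorm_rpow_le_of_half_le {q : ℝ} (hq : q ≤ 0) {u : ℂ} (hu : 1 / 2 < ‖u‖) :
    ‖u‖ₑ ^ q ≤ 2 ^ (-q) := by
  rw [← neg_neg q, ENNReal.rpow_neg, ← ENNReal.inv_rpow, neg_neg]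
  refine ENNReal.rpow_le_rpow ?_ (by linarith)
  rw [ENNReal.inv_le_iff_inv_le, ← ENNReal.ofReal_ofNat, ← ENNReal.ofReal_inv_of_pos (by norm_num),
    ← ofReal_norm]
  exact ENNReal.ofReal_le_ofReal (by norm_num at hu ⊢; linarith)

lemma ae_areaDisc_ne_zero : ∀ᵐ u ∂areaDisc, u ≠ 0 := by
  refine Measure.ae_smul_measure ?_ _
  exact ae_restrict_of_ae (by simp [ae_iff])

lemma lintegral_areaDisc_enorm_rpow_lt_top {q : ℝ} (hq : -2 < q) :
    ∫⁻ u, ‖u‖ₑ ^ q ∂areaDisc < ∞ := by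
  have : ∫⁻ u, ‖u‖ₑ ^ q ∂areaDisc = ∫⁻ u, ENNReal.ofReal (‖u‖ ^ q) ∂areaDisc := by
    refine lintegral_congr_ae ?_
    filter_upwards [ae_areaDisc_ne_zero] with u hu
    rw [← ofReal_norm, ENNReal.ofReal_rpow_of_pos (norm_pos_iff.2 hu)]
  rw [this, lintegral_areaDisc]
  exact ENNReal.mul_lt_top (by simpa using Real.pi_pos) (lintegral_ball_norm_rpow_lt_top hq)

/-- For `p ≥ 4` the weight is at most `1`. For `2 < p < 4`, `|u|^(p-4)` is integrable because `p - 4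
> -2`: on `|u| ≤ 1/2` use `|f|^p ≤ 4 N^p`, and elsewhere bound the weight by `2^(4-p)`. -/
lemma exists_weighted_le {p : ℝ} (hp : 2 < p) : ∃ C : ℝ≥0∞, C ≠ ∞ ∧ (4 ≤ p → C = 1) ∧
    ∀ f : ℂ → ℂ, AnalyticOnNhd ℂ f unitDisc →
    ∫⁻ u, ‖u‖ₑ ^ (p - 4) * ‖unitDisc.indicator f u‖ₑ ^ p ∂areaDisc ≤ C * bergmanNorm p f ^ p := by
  rcases le_or_gt 4 p with h4 | h4
  · exact ⟨1, by simp, fun _ => rfl, fun f _ => weighted_le_of_four_le h4 f⟩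
  have hI := lintegral_areaDisc_enorm_rpow_lt_top (show -2 < p - 4 by linarith)
  set I := ∫⁻ u, ‖u‖ₑ ^ (p - 4) ∂areaDisc
  refine ⟨I * 4 + 2 ^ (-(p - 4)), ?_, fun h => absurd h (not_le.2 h4), fun f hf => ?_⟩
  · refine ENNReal.add_ne_top.2 ⟨ENNReal.mul_ne_top hI.ne (by simp), ?_⟩
    exact ENNReal.rpow_ne_top_of_nonneg (by linarith) (by simp)
  have hp1 : 1 ≤ p := by linarith
  set N := bergmanNorm p f with hN
  calc ∫⁻ u, ‖u‖ₑ ^ (p - 4) * ‖unitDisc.indicator f u‖ₑ ^ p ∂areaDisc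
      ≤ ∫⁻ u, (‖u‖ₑ ^ (p - 4) * (4 * N ^ p) + 2 ^ (-(p - 4)) * ‖f u‖ₑ ^ p) ∂areaDisc := by
        refine lintegral_mono_ae (ae_areaDisc_of_forall fun u hu => ?_)
        rw [Set.indicator_of_mem hu]
        rcases le_or_gt ‖u‖ (1 / 2) with h | h
        · refine le_add_right ?_
          gcongr
          refine (ENNReal.rpow_le_rpow (enorm_le_of_norm_le_half hp1 hf h)
            (by linarith : 0 ≤ p)).trans_eq ?_
          rw [ENNReal.mul_rpow_of_nonneg _ _ (by linarith), ← ENNReal.rpow_mul,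
            div_mul_cancel₀ _ (by linarith : p ≠ 0), hN]
          norm_num
        · refine le_add_left ?_
          gcongr
          exact enorm_rpow_le_of_half_le (by linarith) h
    _ = (I * 4 + 2 ^ (-(p - 4))) * N ^ p := by
        have hm : Measurable fun u : ℂ => ‖u‖ₑ ^ (p - 4) := measurable_enorm.pow_const _
        rw [lintegral_add_left (hm.mul_const _), lintegral_mul_const _ hm, lintegral_const_mul' _ _
          (ENNReal.rpow_ne_top_of_nonneg (by linarith) (by simp)), ← bergmanNorm_rpow hp1]
        ring

/-- Boundedness for `p > 2`. -/
lemma exists_bergmanNorm_Gamma_le_of_two_lt {p : ℝ} (hp : 2 < p) :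
    ∃ B : ℝ≥0∞, B ≠ ∞ ∧ (4 ≤ p → B = 1) ∧ ∀ (μ : Measure ℝ) [IsProbabilityMeasure μ],
      μ (Set.Ico (0 : ℝ) 1)ᶜ = 0 → ∫⁻ t, kernelTheta p t ∂μ ≠ ∞ →
      ∀ f, MemBergman p f → bergmanNorm p (Gamma μ f) ≤
        B * (∫⁻ t, kernelTheta p t ∂μ) * bergmanNorm p f := by
  obtain ⟨C, hC, hC1, hCf⟩ := exists_weighted_le hp
  have hp1 : 1 ≤ p := by linarith
  refine ⟨C ^ (1 / p), ENNReal.rpow_ne_top_of_nonneg (by positivity) hC,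
    fun h => by simp [hC1 h], fun μ _ hμ hfin f hf => ?_⟩
  refine (bergmanNorm_Gamma_le hp1 hμ
    (F := fun q => ‖unitDisc.indicator f (phi q.2 q.1)‖ₑ * ‖weight q.2 q.1‖ₑ)
    (fun t ht z hz => (enorm_T_eq ht hz).le)).trans ?_
  refine (lintegral_rpow_lintegral_le hp1
    (measurable_T_bound measurableSet_unitDisc hf.1.continuousOn)).trans ?_
  -- The kernel is `∞` at `0` when `p > 2`, so finiteness of its integral excludes an atom there;
  -- the change of variables requires `t > 0`.
  have hae : ∀ᵐ t ∂μ, t ∈ Set.Ioo (0 : ℝ) 1 := by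
    filter_upwards [ae_mem_Ico hμ, ae_lt_top (measurable_kernelTheta p) hfin] with t ht ht'
    refine ⟨ht.1.lt_of_ne fun h => ?_, ht.2⟩
    have : 2 / p - 1 < 0 := by rw [sub_neg, div_lt_one (by linarith)]; exact hp
    simp [← h, kernelTheta, ENNReal.zero_rpow_of_neg this] at ht'
  calc _ ≤ ∫⁻ t, kernelTheta p t * (C ^ (1 / p) * bergmanNorm p f) ∂μ := by
        refine lintegral_mono_ae ?_
        filter_upwards [hae] with t ht
        exact lintegral_T_bound_le hp1 (hCf f hf.1) ht
    _ = _ := by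
        rw [lintegral_mul_const _ (measurable_kernelTheta p)]
        ring

/-! ### Upper bound for `p < 2`, and the splitting used for all `p ≤ 2` -/

/-- The part of the disc outside the closed disc of radius `1 / 2`. -/
def outerDisc : Set ℂ := unitDisc \ Metric.closedBall 0 (1 / 2)

lemma measurableSet_outerDisc : MeasurableSet outerDisc :=
  measurableSet_unitDisc.diff measurableSet_closedBall

/-- Since `|u|^(p-4)` is not integrable at the origin for `p ≤ 2`, small values of `φ_t` are handled
by the pointwise bound for `f`; only the outer part undergoes the change of variables. -/
lemma enorm_T_le {p : ℝ} (hp : 1 ≤ p) {f : ℂ → ℂ} (hf : AnalyticOnNhd ℂ f unitDisc)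
    {t : ℝ} (ht : t ∈ Set.Ico (0 : ℝ) 1) {z : ℂ} (hz : z ∈ unitDisc) :
    ‖T t f z‖ₑ ≤ 2 ^ (2 / p) * bergmanNorm p f * ‖weight t z‖ₑ +
      ‖outerDisc.indicator f (phi t z)‖ₑ * ‖weight t z‖ₑ := by
  rw [T, enorm_mul, ← add_mul]
  gcongr
  by_cases h : phi t z ∈ Metric.closedBall (0 : ℂ) (1 / 2)
  · exact le_add_right (enorm_le_of_norm_le_half hp hf (by simpa using h))
  · rw [Set.indicator_of_mem (show phi t z ∈ outerDisc from ⟨phi_mem ht hz, h⟩)]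
    exact le_add_left le_rfl

lemma weighted_outerDisc_le {p : ℝ} (hp : 1 ≤ p) (hp4 : p ≤ 4) (f : ℂ → ℂ) :
    ∫⁻ u, ‖u‖ₑ ^ (p - 4) * ‖outerDisc.indicator f u‖ₑ ^ p ∂areaDisc ≤
      2 ^ (-(p - 4)) * bergmanNorm p f ^ p := by
  rw [bergmanNorm_rpow hp, ← lintegral_const_mul' _ _
    (ENNReal.rpow_ne_top_of_nonneg (by linarith) (by simp))]
  refine lintegral_mono fun u => ?_
  by_cases h : u ∈ outerDisc
  · rw [Set.indicator_of_mem h]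
    gcongr
    refine enorm_rpow_le_of_half_le (by linarith) ?_
    simpa using h.2
  · simp [Set.indicator_of_notMem h, show 0 < p by linarith]

lemma kernelTheta_le_of_le_two {p t : ℝ} (hp : 1 ≤ p) (hp2 : p ≤ 2) (ht : t ∈ Set.Ico (0 : ℝ) 1) :
    kernelTheta p t ≤ 1 / ENNReal.ofReal (1 - t) ^ (2 / p) := by
  unfold kernelTheta
  gcongr
  refine ENNReal.rpow_le_one ?_ ?_
  · simpa using ht.2.le
  · rw [sub_nonneg, le_div_iff₀ (by linarith)]
    linarith

lemma lintegral_outer_le {p : ℝ} (hp : 1 ≤ p) (hp2 : p ≤ 2) (f : ℂ → ℂ) {t : ℝ}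
    (ht : t ∈ Set.Ico (0 : ℝ) 1) :
    (∫⁻ z, (‖outerDisc.indicator f (phi t z)‖ₑ * ‖weight t z‖ₑ) ^ p ∂areaDisc) ^ (1 / p) ≤
      1 / ENNReal.ofReal (1 - t) ^ (2 / p) * ((2 ^ (-(p - 4))) ^ (1 / p) * bergmanNorm p f) := by
  -- At `t = 0` the substitution degenerates, but `φ_0 = 0` never meets the outer region, so the
  -- left side vanishes.
  rcases ht.1.eq_or_lt with h0 | h0
  · have : ∀ z, outerDisc.indicator f (phi t z) = 0 := fun z => by
      rw [phi_eq, ← h0, Set.indicator_of_notMem]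
      simp [outerDisc]
    simp [this, show 0 < p by linarith]
  · refine (lintegral_T_bound_le hp (weighted_outerDisc_le hp (by linarith) f) ⟨h0, ht.2⟩).trans ?_
    gcongr
    exact kernelTheta_le_of_le_two hp hp2 ht

lemma measurable_outer_kernel (p : ℝ) :
    Measurable fun t : ℝ => 1 / ENNReal.ofReal (1 - t) ^ (2 / p) := by
  fun_prop

lemma lintegral_rpow_lintegral_add_le {α β : Type*} [MeasurableSpace α] [MeasurableSpace β]
    {μ : Measure α} {ν : Measure β} [SFinite ν] {p : ℝ} (hp : 1 ≤ p)
    {F G : α × β → ℝ≥0∞} (hF : Measurable F) (hG : Measurable G) (c : ℝ≥0∞) :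
    (∫⁻ z, (∫⁻ t, (c * F (z, t) + G (z, t)) ∂ν) ^ p ∂μ) ^ (1 / p) ≤
      c * (∫⁻ z, (∫⁻ t, F (z, t) ∂ν) ^ p ∂μ) ^ (1 / p) +
        (∫⁻ z, (∫⁻ t, G (z, t) ∂ν) ^ p ∂μ) ^ (1 / p) := by
  have hp0 : 0 < p := by linarith
  have hFi : Measurable fun z => ∫⁻ t, F (z, t) ∂ν := hF.lintegral_prod_right'
  have hGi : Measurable fun z => ∫⁻ t, G (z, t) ∂ν := hG.lintegral_prod_right'
  have e : ∀ z, ∫⁻ t, (c * F (z, t) + G (z, t)) ∂ν =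
      ((fun z => c * ∫⁻ t, F (z, t) ∂ν) + fun z => ∫⁻ t, G (z, t) ∂ν) z := fun z => by
    have h1 : Measurable fun t => F (z, t) := hF.comp measurable_prodMk_left
    rw [lintegral_add_left (h1.const_mul _), lintegral_const_mul _ h1]
    rfl
  simp only [e]
  refine (ENNReal.lintegral_Lp_add_le (hFi.const_mul _).aemeasurable
    hGi.aemeasurable hp).trans ?_
  refine add_le_add (le_of_eq ?_) le_rfl
  simp_rw [ENNReal.mul_rpow_of_nonneg _ _ hp0.le]
  rw [lintegral_const_mul _ (hFi.pow_const _), ENNReal.mul_rpow_of_nonneg _ _ (by positivity),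
    ← ENNReal.rpow_mul, mul_one_div_cancel hp0.ne', ENNReal.rpow_one]

/-- For `p ≤ 2` the norm of `Γ_μ f` is controlled by the norm of `∫ |w_t| dμ`. -/
lemma bergmanNorm_Gamma_le_of_le_two {p : ℝ} (hp : 1 ≤ p) (hp2 : p ≤ 2) {μ : Measure ℝ}
    [IsProbabilityMeasure μ] (hμ : μ (Set.Ico (0 : ℝ) 1)ᶜ = 0) {f : ℂ → ℂ}
    (hf : MemBergman p f) :
    bergmanNorm p (Gamma μ f) ≤
      (2 ^ (2 / p) * (∫⁻ z, (∫⁻ t, ‖weight t z‖ₑ ∂μ) ^ p ∂areaDisc) ^ (1 / p) +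
        (2 ^ (-(p - 4))) ^ (1 / p) * ∫⁻ t, 1 / ENNReal.ofReal (1 - t) ^ (2 / p) ∂μ) *
      bergmanNorm p f := by
  have hp0 : 0 < p := by linarith
  have hout := measurable_T_bound measurableSet_outerDisc
    (hf.1.continuousOn.mono (Set.sdiff_subset : outerDisc ⊆ unitDisc))
  have hw : Measurable fun q : ℂ × ℝ => ‖weight q.2 q.1‖ₑ := measurable_weight.enorm
  set N := bergmanNorm p f
  refine (bergmanNorm_Gamma_le hp hμ (F := fun q => 2 ^ (2 / p) * N * ‖weight q.2 q.1‖ₑ +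
      ‖outerDisc.indicator f (phi q.2 q.1)‖ₑ * ‖weight q.2 q.1‖ₑ)
    (fun t ht z hz => enorm_T_le hp hf.1 ht hz)).trans ?_
  refine (lintegral_rpow_lintegral_add_le hp hw hout _).trans ?_
  rw [add_mul]
  refine add_le_add (le_of_eq (by ring)) ?_
  · refine (lintegral_rpow_lintegral_le hp hout).trans ?_
    calc _ ≤ ∫⁻ t, 1 / ENNReal.ofReal (1 - t) ^ (2 / p) *
          ((2 ^ (-(p - 4))) ^ (1 / p) * N) ∂μ := by
          refine lintegral_mono_ae ?_
          filter_upwards [ae_mem_Ico hμ] with t ht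
          exact lintegral_outer_le hp hp2 f ht
      _ = _ := by
          rw [lintegral_mul_const _ (measurable_outer_kernel p)]
          ring

lemma one_le_outer_kernel {p t : ℝ} (hp : 1 ≤ p) (ht : t ∈ Set.Ico (0 : ℝ) 1) :
    1 ≤ 1 / ENNReal.ofReal (1 - t) ^ (2 / p) := by
  rw [one_div, ENNReal.one_le_inv]
  refine ENNReal.rpow_le_one ?_ (by positivity)
  simpa using ht.1

lemma one_le_lintegral_outer_kernel {p : ℝ} (hp : 1 ≤ p) {μ : Measure ℝ}
    [IsProbabilityMeasure μ] (hμ : μ (Set.Ico (0 : ℝ) 1)ᶜ = 0) :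
    1 ≤ ∫⁻ t, 1 / ENNReal.ofReal (1 - t) ^ (2 / p) ∂μ := by
  calc (1 : ℝ≥0∞) = ∫⁻ _, 1 ∂μ := by simp
    _ ≤ _ := lintegral_mono_ae (by
      filter_upwards [ae_mem_Ico hμ] with t ht using one_le_outer_kernel hp ht)

/-- Boundedness for `p < 2`. -/
lemma exists_bergmanNorm_Gamma_le_of_lt_two {p : ℝ} (hp : 1 ≤ p) (hp2 : p < 2) :
    ∃ B : ℝ≥0∞, B ≠ ∞ ∧ ∀ (μ : Measure ℝ) [IsProbabilityMeasure μ],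
      μ (Set.Ico (0 : ℝ) 1)ᶜ = 0 → ∀ f, MemBergman p f → bergmanNorm p (Gamma μ f) ≤
        B * (∫⁻ t, 1 / ENNReal.ofReal (1 - t) ^ (2 / p) ∂μ) * bergmanNorm p f := by
  have hp0 : 0 < p := by linarith
  -- The `L^p` norm of `4 / |1 - z|`, finite exactly because `p < 2`; it dominates that of `∫ |w_t|
  -- dμ` for every probability `μ`.
  set W := (∫⁻ z, ENNReal.ofReal (4 ^ p * ‖1 - z‖ ^ (-p)) ∂areaDisc) ^ (1 / p) with hW
  have hWfin : W ≠ ∞ := by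
    refine ENNReal.rpow_ne_top_of_nonneg (by positivity) ?_
    simp_rw [ENNReal.ofReal_mul (show (0 : ℝ) ≤ 4 ^ p by positivity)]
    rw [lintegral_const_mul' _ _ ENNReal.ofReal_ne_top]
    exact ENNReal.mul_ne_top ENNReal.ofReal_ne_top
      (lintegral_areaDisc_one_sub_rpow_lt_top (by linarith)).ne
  refine ⟨2 ^ (2 / p) * W + (2 ^ (-(p - 4))) ^ (1 / p), ?_, fun μ _ hμ f hf => ?_⟩
  · refine ENNReal.add_ne_top.2 ⟨ENNReal.mul_ne_top ?_ hWfin, ?_⟩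
    · exact ENNReal.rpow_ne_top_of_nonneg (by positivity) (by simp)
    · exact ENNReal.rpow_ne_top_of_nonneg (by positivity)
        (ENNReal.rpow_ne_top_of_nonneg (by linarith) (by simp))
  · refine (bergmanNorm_Gamma_le_of_le_two hp hp2.le hμ hf).trans ?_
    refine mul_le_mul' ?_ le_rfl
    rw [add_mul]
    refine add_le_add ?_ le_rfl
    rw [mul_assoc]
    refine mul_le_mul' le_rfl ?_
    -- The bound `W` does not involve `μ`; it is absorbed because the kernel integral is at least
    -- `1`.
    refine le_mul_of_le_of_one_le ?_ (one_le_lintegral_outer_kernel hp hμ)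
    refine ENNReal.rpow_le_rpow (lintegral_mono_ae (ae_areaDisc_of_forall fun z hz => ?_))
      (by positivity)
    have h1 : ∫⁻ t, ‖weight t z‖ₑ ∂μ ≤ ENNReal.ofReal (4 * ‖1 - z‖⁻¹) := by
      calc _ ≤ ∫⁻ _, ENNReal.ofReal (4 * ‖1 - z‖⁻¹) ∂μ := by
            refine lintegral_mono_ae ?_
            filter_upwards [ae_mem_Ico hμ] with t ht
            rw [← ofReal_norm]
            exact ENNReal.ofReal_le_ofReal (norm_weight_le_four_div ht hz)
        _ = _ := by simp
    refine (ENNReal.rpow_le_rpow h1 hp0.le).trans_eq ?_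
    rw [ENNReal.ofReal_rpow_of_nonneg (by positivity) hp0.le,
      Real.mul_rpow (by norm_num) (by positivity), Real.inv_rpow (norm_nonneg _),
      Real.rpow_neg (norm_nonneg _)]

/-! ### Upper bound for `p = 2`: the logarithmic energy -/

lemma lintegral_areaDisc_one_sub_le_radial {h : ℝ → ℝ≥0∞} (hh : Measurable h) :
    ∫⁻ z, h ‖1 - z‖ ∂areaDisc ≤ 2 * ∫⁻ r in Set.Ioo (0 : ℝ) 2, ENNReal.ofReal r * h r := by
  refine (lintegral_areaDisc_one_sub_le h).trans ?_
  have e : ∫⁻ u in Metric.ball (0 : ℂ) 2, h ‖u‖ = ∫⁻ u : ℂ, (Set.Iio 2).indicator h ‖u‖ := by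
    rw [← lintegral_indicator measurableSet_ball]
    refine lintegral_congr fun u => ?_
    by_cases hu : ‖u‖ < 2
    · rw [Set.indicator_of_mem (by simpa using hu), Set.indicator_of_mem (Set.mem_Iio.2 hu)]
    · rw [Set.indicator_of_notMem (by simpa using hu), Set.indicator_of_notMem (by simpa using hu)]
  rw [e, lintegral_norm_fun (hh.indicator measurableSet_Iio), ← mul_assoc,
    ENNReal.ofReal_mul zero_le_two, mul_left_comm, ENNReal.ofReal_ofNat,
    ENNReal.inv_mul_cancel (by simpa using Real.pi_pos) ENNReal.ofReal_ne_top, mul_one]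
  refine mul_le_mul' le_rfl (le_of_eq ?_)
  rw [← Set.Ioi_inter_Iio, Set.inter_comm, ← Measure.restrict_restrict measurableSet_Iio,
    ← lintegral_indicator measurableSet_Iio]
  refine lintegral_congr fun r => ?_
  by_cases hr : r ∈ Set.Iio (2 : ℝ)
  · rw [Set.indicator_of_mem hr, Set.indicator_of_mem hr]
  · rw [Set.indicator_of_notMem hr, Set.indicator_of_notMem hr, mul_zero]

lemma lintegral_Ico_inv {a b : ℝ} (ha : 0 < a) (hab : a ≤ b) :
    ∫⁻ r in Set.Ico a b, ENNReal.ofReal r⁻¹ = ENNReal.ofReal (Real.log (b / a)) := by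
  have h : IntegrableOn (fun r : ℝ => r⁻¹) (Set.Ioc a b) := by
    have : IntervalIntegrable (fun r : ℝ => r⁻¹) volume a b := by
      refine intervalIntegral.intervalIntegrable_inv (fun x hx => ?_) continuousOn_id
      rw [Set.uIcc_of_le hab] at hx
      exact (ha.trans_le hx.1).ne'
    rwa [intervalIntegrable_iff_integrableOn_Ioc_of_le hab] at this
  rw [restrict_Ico_eq_restrict_Ioc, ← ofReal_integral_eq_lintegral_ofReal h,
    ← intervalIntegral.integral_of_le hab, integral_inv_of_pos ha (ha.trans_le hab)]
  exact (ae_restrict_iff' measurableSet_Ioc).2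
    (Filter.Eventually.of_forall fun x hx => inv_nonneg.2 (ha.trans hx.1).le)

lemma logE_eq {t : ℝ} (ht : 0 < t) : logE t = ENNReal.ofReal (1 - Real.log t) := by
  rw [logE, if_neg ht.ne', Real.log_div (Real.exp_pos _).ne' ht.ne', Real.log_exp]

lemma measurable_logE : Measurable logE := by
  unfold logE
  exact Measurable.ite (measurableSet_singleton 0) measurable_const
    (ENNReal.measurable_ofReal.comp (Real.measurable_log.comp (measurable_const.div measurable_id)))

/-- With `r = |1 - z|`, use `|w_t| ≤ min(1/t, 4/r)` and `|w_s| ≤ 4/r`. The zone `r < t` contributes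
a constant and `t ≤ r < 2` contributes a multiple of `log (2/t)`. It is applied with `t` the larger
of the two parameters. -/
lemma lintegral_weight_mul_weight_le {t s : ℝ} (ht : t ∈ Set.Ico (0 : ℝ) 1)
    (hs : s ∈ Set.Ico (0 : ℝ) 1) :
    ∫⁻ z, ‖weight t z‖ₑ * ‖weight s z‖ₑ ∂areaDisc ≤ 32 * logE t := by
  rcases ht.1.eq_or_lt with h0 | h0
  · simp [← h0, logE]
  set h : ℝ → ℝ≥0∞ := fun r => ENNReal.ofReal (min (t⁻¹) (4 * r⁻¹) * (4 * r⁻¹)) with hh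
  have hm : Measurable h := ENNReal.measurable_ofReal.comp (by fun_prop)
  calc ∫⁻ z, ‖weight t z‖ₑ * ‖weight s z‖ₑ ∂areaDisc ≤ ∫⁻ z, h ‖1 - z‖ ∂areaDisc := by
        refine lintegral_mono_ae (ae_areaDisc_of_forall fun z hz => ?_)
        rw [← ofReal_norm, ← ofReal_norm, ← ENNReal.ofReal_mul (norm_nonneg _)]
        refine ENNReal.ofReal_le_ofReal (mul_le_mul (le_min (norm_weight_le_inv_self ht h0 hz)
          (norm_weight_le_four_div ht hz)) (norm_weight_le_four_div hs hz) (norm_nonneg _) ?_)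
        positivity
    _ ≤ 2 * ∫⁻ r in Set.Ioo (0 : ℝ) 2, ENNReal.ofReal r * h r :=
        lintegral_areaDisc_one_sub_le_radial hm
    _ ≤ 2 * ((∫⁻ _ in Set.Ioo (0 : ℝ) t, ENNReal.ofReal (4 * t⁻¹)) +
          ∫⁻ r in Set.Ico t 2, ENNReal.ofReal 16 * ENNReal.ofReal r⁻¹) := by
        refine mul_le_mul' le_rfl ?_
        rw [← Set.Ioo_union_Ico_eq_Ioo h0 (show t ≤ 2 by linarith [ht.2])]
        refine (lintegral_union_le _ _ _).trans (add_le_add ?_ ?_)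
        · refine setLIntegral_mono' measurableSet_Ioo fun r hr => ?_
          rw [hh, ← ENNReal.ofReal_mul hr.1.le]
          refine ENNReal.ofReal_le_ofReal ?_
          have h1 := hr.1
          calc r * (min (t⁻¹) (4 * r⁻¹) * (4 * r⁻¹)) ≤ r * (t⁻¹ * (4 * r⁻¹)) := by
                gcongr; exact min_le_left _ _
            _ = 4 * t⁻¹ := by field_simp
        · refine setLIntegral_mono' measurableSet_Ico fun r hr => ?_
          have h1 : 0 < r := h0.trans_le hr.1
          rw [hh, ← ENNReal.ofReal_mul h1.le, ← ENNReal.ofReal_mul (by norm_num)]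
          refine ENNReal.ofReal_le_ofReal ?_
          calc r * (min (t⁻¹) (4 * r⁻¹) * (4 * r⁻¹)) ≤ r * ((4 * r⁻¹) * (4 * r⁻¹)) := by
                gcongr; exact min_le_right _ _
            _ = 16 * r⁻¹ := by field_simp; norm_num
    _ = ENNReal.ofReal (2 * (4 + 16 * Real.log (2 / t))) := by
        have hlog : 0 ≤ Real.log (2 / t) :=
          Real.log_nonneg (by rw [le_div_iff₀ h0]; linarith [ht.2])
        rw [lintegral_const, lintegral_const_mul' _ _ ENNReal.ofReal_ne_top,
          lintegral_Ico_inv h0 (by linarith [ht.2]), Measure.restrict_apply_univ, Real.volume_Ioo,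
          ← ENNReal.ofReal_mul (by positivity), ← ENNReal.ofReal_mul (by positivity),
          ← ENNReal.ofReal_add (by rw [sub_zero]; positivity) (by positivity),
          ← ENNReal.ofReal_ofNat 2, ← ENNReal.ofReal_mul (by positivity)]
        congr 3
        field_simp
        simp
    _ ≤ 32 * logE t := by
        rw [logE_eq h0, ← ENNReal.ofReal_ofNat 32, ← ENNReal.ofReal_mul (by norm_num)]
        refine ENNReal.ofReal_le_ofReal ?_
        rw [Real.log_div (by norm_num) h0.ne']
        -- The numerical condition is `8 + 32 log 2 ≤ 32`.
        linarith [Real.log_two_lt_d9]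

/-- The logarithmic energy in the definition of `Theta` for `p = 2`. -/
def logEnergy (μ : Measure ℝ) : ℝ≥0∞ := ∫⁻ s, μ (Set.Icc 0 s) * logE s ∂μ

lemma measurable_logE_triangle :
    Measurable fun q : ℝ × ℝ => {q : ℝ × ℝ | q.2 ≤ q.1}.indicator (fun q => logE q.1) q :=
  (measurable_logE.comp measurable_fst).indicator (measurableSet_le measurable_snd measurable_fst)

lemma logEnergy_eq {μ : Measure ℝ} (hμ : μ (Set.Ico (0 : ℝ) 1)ᶜ = 0) :
    logEnergy μ = ∫⁻ t, ∫⁻ s, {q : ℝ × ℝ | q.2 ≤ q.1}.indicator (fun q => logE q.1) (t, s) ∂μ ∂μ := by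
  refine lintegral_congr fun t => ?_
  have : ∀ s, {q : ℝ × ℝ | q.2 ≤ q.1}.indicator (fun q => logE q.1) (t, s) =
      (Set.Iic t).indicator (fun _ => logE t) s := fun s => rfl
  simp_rw [this]
  rw [lintegral_indicator measurableSet_Iic, setLIntegral_const, mul_comm]
  congr 1
  refine measure_congr ?_
  filter_upwards [ae_mem_Ico hμ] with s hs
  exact propext ⟨fun h => h.2, fun h => ⟨hs.1, h⟩⟩

/-- Expanding the square and applying Tonelli reduces the `L²` estimates, in both directions, to
pairs of weights. -/
lemma lintegral_sq_lintegral {α β : Type*} [MeasurableSpace α] [MeasurableSpace β]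
    {ν : Measure α} {μ : Measure β} [SFinite ν] [SFinite μ] {w : α × β → ℝ≥0∞}
    (hw : Measurable w) :
    ∫⁻ z, (∫⁻ t, w (z, t) ∂μ) ^ (2 : ℝ) ∂ν =
      ∫⁻ t, ∫⁻ s, ∫⁻ z, w (z, t) * w (z, s) ∂ν ∂μ ∂μ := by
  have hwz : ∀ z, Measurable fun t => w (z, t) := fun z => hw.comp measurable_prodMk_left
  have hwi : Measurable fun z => ∫⁻ t, w (z, t) ∂μ := hw.lintegral_prod_right'
  calc ∫⁻ z, (∫⁻ t, w (z, t) ∂μ) ^ (2 : ℝ) ∂ν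
      = ∫⁻ z, ∫⁻ t, w (z, t) * ∫⁻ s, w (z, s) ∂μ ∂μ ∂ν := by
        refine lintegral_congr fun z => ?_
        rw [lintegral_mul_const _ (hwz z), ENNReal.rpow_two, sq]
    _ = ∫⁻ t, ∫⁻ z, w (z, t) * ∫⁻ s, w (z, s) ∂μ ∂ν ∂μ :=
        lintegral_lintegral_swap (f := fun z t => w (z, t) * ∫⁻ s, w (z, s) ∂μ)
          (hw.mul (hwi.comp measurable_fst)).aemeasurable
    _ = ∫⁻ t, ∫⁻ z, ∫⁻ s, w (z, t) * w (z, s) ∂μ ∂ν ∂μ := by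
        refine lintegral_congr fun t => lintegral_congr fun z => ?_
        rw [lintegral_const_mul _ (hwz z)]
    _ = ∫⁻ t, ∫⁻ s, ∫⁻ z, w (z, t) * w (z, s) ∂ν ∂μ ∂μ := by
        refine lintegral_congr fun t => ?_
        refine lintegral_lintegral_swap (f := fun z s => w (z, t) * w (z, s))
          (Measurable.aemeasurable ?_)
        have h1 : Measurable fun q : α × β => w (q.1, t) :=
          hw.comp (measurable_fst.prodMk measurable_const)
        exact h1.mul hw

/-- The symmetrized kernel is `log (e / max(s, t))` off the diagonal and twice that on it. Counting
the diagonal twice gives exactly `2 * logEnergy μ`, even when `μ` has atoms. -/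
lemma lintegral_logE_triangle_add {μ : Measure ℝ} [SFinite μ]
    (hμ : μ (Set.Ico (0 : ℝ) 1)ᶜ = 0) :
    ∫⁻ t, ∫⁻ s, ({q : ℝ × ℝ | q.2 ≤ q.1}.indicator (fun q => logE q.1) (t, s) +
      {q : ℝ × ℝ | q.2 ≤ q.1}.indicator (fun q => logE q.1) (s, t)) ∂μ ∂μ = 2 * logEnergy μ := by
  have hE := logEnergy_eq hμ
  have hLm := measurable_logE_triangle
  revert hE hLm
  generalize {q : ℝ × ℝ | q.2 ≤ q.1}.indicator (fun q => logE q.1) = L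
  intro hE hLm
  have h1 : Measurable fun t => ∫⁻ s, L (t, s) ∂μ := hLm.lintegral_prod_right'
  have h3 : ∀ t, ∫⁻ s, (L (t, s) + L (s, t)) ∂μ = ∫⁻ s, L (t, s) ∂μ + ∫⁻ s, L (s, t) ∂μ :=
    fun t => lintegral_add_left (f := fun s => L (t, s)) (hLm.comp measurable_prodMk_left) _
  simp_rw [h3]
  rw [lintegral_add_left h1, lintegral_lintegral_swap (f := fun t s => L (s, t))
    (hLm.comp measurable_swap).aemeasurable, ← hE, two_mul]

lemma lintegral_weight_sq_le {μ : Measure ℝ} [IsProbabilityMeasure μ]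
    (hμ : μ (Set.Ico (0 : ℝ) 1)ᶜ = 0) :
    ∫⁻ z, (∫⁻ t, ‖weight t z‖ₑ ∂μ) ^ (2 : ℝ) ∂areaDisc ≤ 64 * logEnergy μ := by
  have hw : Measurable fun q : ℂ × ℝ => ‖weight q.2 q.1‖ₑ := measurable_weight.enorm
  have h64 : 64 * logEnergy μ = 32 * (2 * logEnergy μ) := by rw [← mul_assoc]; norm_num
  rw [lintegral_sq_lintegral hw, h64, ← lintegral_logE_triangle_add hμ,
    ← lintegral_const_mul' _ _ (by simp)]
  refine lintegral_mono_ae ?_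
  filter_upwards [ae_mem_Ico hμ] with t ht
  rw [← lintegral_const_mul' _ _ (by simp)]
  refine lintegral_mono_ae ?_
  filter_upwards [ae_mem_Ico hμ] with s hs
  rcases le_total s t with h | h
  · refine (lintegral_weight_mul_weight_le ht hs).trans (mul_le_mul' le_rfl (le_add_right ?_))
    rw [Set.indicator_of_mem (by exact h)]
  · simp_rw [mul_comm ‖weight t _‖ₑ]
    refine (lintegral_weight_mul_weight_le hs ht).trans (mul_le_mul' le_rfl (le_add_left ?_))
    rw [Set.indicator_of_mem (by exact h)]

lemma Theta_two (μ : Measure ℝ) (t : ℝ) :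
    Theta μ 2 t = (logEnergy μ + (∫⁻ s, 1 / ENNReal.ofReal (1 - s) ∂μ) ^ 2) ^ (1 / 2 : ℝ) := by
  simp [Theta, logEnergy]

lemma rpow_half_sq (x : ℝ≥0∞) : (x ^ 2) ^ (1 / 2 : ℝ) = x := by
  rw [← ENNReal.rpow_natCast, ← ENNReal.rpow_mul]
  norm_num

/-- Boundedness for `p = 2`. -/
lemma bergmanNorm_two_Gamma_le {μ : Measure ℝ} [IsProbabilityMeasure μ]
    (hμ : μ (Set.Ico (0 : ℝ) 1)ᶜ = 0) {f : ℂ → ℂ} (hf : MemBergman 2 f) :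
    bergmanNorm 2 (Gamma μ f) ≤ 18 * (∫⁻ t, Theta μ 2 t ∂μ) * bergmanNorm 2 f := by
  refine (bergmanNorm_Gamma_le_of_le_two one_le_two le_rfl hμ hf).trans ?_
  refine mul_le_mul' ?_ le_rfl
  simp_rw [Theta_two]
  rw [lintegral_const, measure_univ, mul_one]
  set Λ := logEnergy μ with hΛ
  set K := ∫⁻ s, 1 / ENNReal.ofReal (1 - s) ∂μ with hK
  have h1 : (∫⁻ z, (∫⁻ t, ‖weight t z‖ₑ ∂μ) ^ (2 : ℝ) ∂areaDisc) ^ (1 / 2 : ℝ) ≤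
      8 * (Λ + K ^ 2) ^ (1 / 2 : ℝ) := by
    refine (ENNReal.rpow_le_rpow ((lintegral_weight_sq_le hμ).trans
      (mul_le_mul' le_rfl (le_add_right le_rfl : Λ ≤ Λ + K ^ 2)))
      (by norm_num : (0 : ℝ) ≤ 1 / 2)).trans_eq ?_
    rw [ENNReal.mul_rpow_of_nonneg _ _ (by norm_num), show (64 : ℝ≥0∞) = 8 ^ 2 by norm_num,
      rpow_half_sq]
  have h2 : K ≤ (Λ + K ^ 2) ^ (1 / 2 : ℝ) := by
    nth_rewrite 1 [← rpow_half_sq K]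
    exact ENNReal.rpow_le_rpow (le_add_left le_rfl) (by norm_num)
  have e1 : (2 : ℝ≥0∞) ^ (2 / 2 : ℝ) = 2 := by norm_num
  have e2 : ((2 : ℝ≥0∞) ^ (-(2 - 4) : ℝ)) ^ (1 / 2 : ℝ) = 2 := by
    rw [← ENNReal.rpow_mul]; norm_num
  have e3 : ∫⁻ t, 1 / ENNReal.ofReal (1 - t) ^ (2 / 2 : ℝ) ∂μ = K := by
    norm_num [hK]
  rw [e1, e2, e3]
  -- Here `8 = √64` comes from the energy bound, the two factors `2` from the inner and outer parts,
  -- and `18 = 2 · 8 + 2`.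
  calc _ ≤ 2 * (8 * (Λ + K ^ 2) ^ (1 / 2 : ℝ)) + 2 * (Λ + K ^ 2) ^ (1 / 2 : ℝ) := by gcongr
    _ = _ := by ring

/-! ### Absolute convergence and analyticity -/

lemma norm_le_bergmanNorm {p : ℝ} (hp : 1 ≤ p) {f : ℂ → ℂ} (hf : MemBergman p f)
    {z : ℂ} (hz : z ∈ unitDisc) :
    ‖f z‖ ≤ (1 - ‖z‖) ^ (-(2 / p)) * (bergmanNorm p f).toReal := by
  have h1 : 0 < 1 - ‖z‖ := by
    have : ‖z‖ < 1 := by simpa [unitDisc] using hz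
    linarith
  have h := enorm_le_bergmanNorm hp hf.1 hz
  rw [ENNReal.ofReal_rpow_of_pos h1, ← ofReal_norm, ← ENNReal.ofReal_toReal hf.2.ne,
    ← ENNReal.ofReal_mul (by positivity)] at h
  exact (ENNReal.ofReal_le_ofReal_iff (by positivity)).1 h

/-- Combining the growth of `f` with `1 - |φ_t(z)| ≥ (1 - t)(1 - |z|)` separates `t` from `z`; this
gives a majorant uniform on compact subsets of the disc. -/
lemma norm_T_le {p : ℝ} (hp : 1 ≤ p) {f : ℂ → ℂ} (hf : MemBergman p f)
    {t : ℝ} (ht : t ∈ Set.Ico (0 : ℝ) 1) {r : ℝ} (hr : r < 1) {z : ℂ} (hz : ‖z‖ ≤ r) :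
    ‖T t f z‖ ≤ (1 - r) ^ (-(2 / p)) * (bergmanNorm p f).toReal * (1 - r)⁻¹ *
      (1 - t) ^ (-(2 / p)) := by
  have hzD : z ∈ unitDisc := by simpa [unitDisc] using hz.trans_lt hr
  have h1t := sub_pos.2 ht.2
  have h1r := sub_pos.2 hr
  have h1z : 0 < 1 - ‖z‖ := by linarith
  rw [T, norm_mul]
  have hφ := phi_mem ht hzD
  have h1 := norm_le_bergmanNorm hp hf hφ
  have h2 := norm_weight_le_inv ht hzD
  have h3 : (1 - ‖phi t z‖) ^ (-(2 / p)) ≤ (1 - t) ^ (-(2 / p)) * (1 - r) ^ (-(2 / p)) := by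
    rw [← Real.mul_rpow h1t.le h1r.le]
    refine Real.rpow_le_rpow_of_nonpos (by positivity) ?_ ?_
    · refine le_trans ?_ (one_sub_norm_phi ht hzD)
      gcongr
    · have : 0 ≤ 2 / p := by positivity
      linarith
  calc ‖f (phi t z)‖ * ‖weight t z‖ ≤
      ((1 - t) ^ (-(2 / p)) * (1 - r) ^ (-(2 / p)) * (bergmanNorm p f).toReal) * (1 - r)⁻¹ := by
        refine mul_le_mul (h1.trans (by gcongr)) (h2.trans ?_) (norm_nonneg _) (by positivity)
        exact inv_anti₀ h1r (by linarith)
    _ = _ := by ring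

lemma hasDerivAt_weight {t : ℝ} (ht : t ∈ Set.Ico (0 : ℝ) 1) {z : ℂ} (hz : z ∈ unitDisc) :
    HasDerivAt (weight t) ((1 - t) * weight t z ^ 2) z := by
  have h := (hasDerivAt_den t z).inv (den_ne_zero ht hz)
  have e : weight t = (den t)⁻¹ := funext fun z => by simp [weight_eq]
  rw [e]
  refine h.congr_deriv ?_
  rw [Pi.inv_apply]
  field_simp
  ring

lemma hasDerivAt_T {f : ℂ → ℂ} (hf : AnalyticOnNhd ℂ f unitDisc) {t : ℝ}
    (ht : t ∈ Set.Ico (0 : ℝ) 1) {z : ℂ} (hz : z ∈ unitDisc) :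
    HasDerivAt (T t f) (deriv f (phi t z) * (t * (1 - t) * weight t z ^ 2) * weight t z +
      f (phi t z) * ((1 - t) * weight t z ^ 2)) z :=
  ((hf _ (phi_mem ht hz)).differentiableAt.hasDerivAt.comp z (hasDerivAt_phi ht hz)).mul
    (hasDerivAt_weight ht hz)

lemma aestronglyMeasurable_comp_phi {μ : Measure ℝ} (hμ : μ (Set.Ico (0 : ℝ) 1)ᶜ = 0)
    {f : ℂ → ℂ} (hf : ContinuousOn f unitDisc) {z : ℂ} (hz : z ∈ unitDisc) :
    AEStronglyMeasurable (fun t => f (phi t z)) μ := by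
  have h : Measurable fun t => unitDisc.indicator f (phi t z) :=
    (measurable_indicator_of_continuousOn hf measurableSet_unitDisc).comp
      (measurable_phi.comp (measurable_prodMk_left (x := z)))
  refine h.aestronglyMeasurable.congr ?_
  filter_upwards [ae_mem_Ico hμ] with t ht
  rw [Set.indicator_of_mem (phi_mem ht hz)]

lemma aestronglyMeasurable_weight (μ : Measure ℝ) (z : ℂ) :
    AEStronglyMeasurable (fun t => weight t z) μ :=
  (measurable_weight.comp (measurable_prodMk_left (x := z))).aestronglyMeasurable

lemma aestronglyMeasurable_T {μ : Measure ℝ} (hμ : μ (Set.Ico (0 : ℝ) 1)ᶜ = 0)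
    {f : ℂ → ℂ} (hf : ContinuousOn f unitDisc) {z : ℂ} (hz : z ∈ unitDisc) :
    AEStronglyMeasurable (fun t => T t f z) μ :=
  (aestronglyMeasurable_comp_phi hμ hf hz).mul (aestronglyMeasurable_weight μ z)

lemma integrable_one_sub_rpow {p : ℝ} {μ : Measure ℝ} (hμ : μ (Set.Ico (0 : ℝ) 1)ᶜ = 0)
    (hfin : ∫⁻ t, 1 / ENNReal.ofReal (1 - t) ^ (2 / p) ∂μ ≠ ∞) :
    Integrable (fun t : ℝ => (1 - t) ^ (-(2 / p))) μ := by
  refine ⟨(Measurable.pow_const (by fun_prop) _).aestronglyMeasurable, ?_⟩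
  refine lt_of_le_of_lt (lintegral_mono_ae ?_) hfin.lt_top
  filter_upwards [ae_mem_Ico hμ] with t ht
  have h1t := sub_pos.2 ht.2
  rw [← ofReal_norm, Real.norm_of_nonneg (by positivity), ENNReal.ofReal_rpow_of_pos h1t,
    Real.rpow_neg h1t.le, ENNReal.ofReal_inv_of_pos (by positivity), one_div]

/-- `Γ_μ` is well defined as soon as `∫ (1 - t)^(-2/p) dμ(t)` is finite. -/
lemma gammaDefined_of_lintegral_ne_top {p : ℝ} (hp : 1 ≤ p) {μ : Measure ℝ}
    (hμ : μ (Set.Ico (0 : ℝ) 1)ᶜ = 0)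
    (hfin : ∫⁻ t, 1 / ENNReal.ofReal (1 - t) ^ (2 / p) ∂μ ≠ ∞) : GammaDefined μ p := by
  intro f hf
  have hk := integrable_one_sub_rpow hμ hfin
  have hc := hf.1.continuousOn
  have hint : ∀ z ∈ unitDisc, Integrable (fun t => T t f z) μ := by
    intro z hz
    have hz1 : ‖z‖ < 1 := by simpa [unitDisc] using hz
    refine Integrable.mono' (hk.const_mul
      ((1 - ‖z‖) ^ (-(2 / p)) * (bergmanNorm p f).toReal * (1 - ‖z‖)⁻¹)) (aestronglyMeasurable_T hμ hc hz) ?_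
    filter_upwards [ae_mem_Ico hμ] with t ht using norm_T_le hp hf ht hz1 le_rfl
  refine ⟨hint, DifferentiableOn.analyticOnNhd (fun z hz => ?_) isOpen_unitDisc⟩
  have hz1 : ‖z‖ < 1 := by simpa [unitDisc] using hz
  -- One third for moving the base point, one for the Cauchy circle about it, one for the remaining
  -- distance to the boundary.
  set ε := (1 - ‖z‖) / 3 with hε
  have hε0 : 0 < ε := by rw [hε]; linarith
  set r := 1 - ε with hrdef
  have hr1 : r < 1 := by linarith
  have hnorm : ∀ x ∈ Metric.ball z ε, ∀ y ∈ Metric.closedBall x ε, ‖y‖ ≤ r := by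
    intro x hx y hy
    have h1 : ‖x - z‖ < ε := by simpa [dist_eq_norm] using hx
    have h2 : ‖y - x‖ ≤ ε := by simpa [dist_eq_norm] using hy
    have h3 : ‖y‖ ≤ ‖y - x‖ + ‖x - z‖ + ‖z‖ := by
      calc ‖y‖ = ‖(y - x) + (x - z) + z‖ := by ring_nf
        _ ≤ _ := norm_add₃_le
    linarith
  have hsub : ∀ x ∈ Metric.ball z ε, Metric.closedBall x ε ⊆ unitDisc := fun x hx y hy => by
    simpa [unitDisc] using (hnorm x hx y hy).trans_lt hr1
  have hmem : ∀ x ∈ Metric.ball z ε, x ∈ unitDisc := fun x hx =>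
    hsub x hx (Metric.mem_closedBall_self hε0.le)
  refine DifferentiableAt.differentiableWithinAt (HasDerivAt.differentiableAt
    (hasDerivAt_integral_of_dominated_loc_of_deriv_le (F := fun x t => T t f x)
      (F' := fun x t => deriv f (phi t x) * (t * (1 - t) * weight t x ^ 2) * weight t x +
      f (phi t x) * ((1 - t) * weight t x ^ 2))
      (bound := fun t => (1 - r) ^ (-(2 / p)) * (bergmanNorm p f).toReal * (1 - r)⁻¹ *
        (1 - t) ^ (-(2 / p)) / ε) (Metric.ball_mem_nhds z hε0) ?_ (hint z hz) ?_ ?_ ?_ ?_).2)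
  · filter_upwards [isOpen_unitDisc.mem_nhds hz] with x hx using aestronglyMeasurable_T hμ hc hx
  · have hw := aestronglyMeasurable_weight μ z
    have ht : AEStronglyMeasurable (fun t : ℝ => (t : ℂ)) μ :=
      Complex.continuous_ofReal.aestronglyMeasurable
    have h1t : AEStronglyMeasurable (fun t : ℝ => 1 - (t : ℂ)) μ :=
      (continuous_const.sub Complex.continuous_ofReal).aestronglyMeasurable
    exact (((aestronglyMeasurable_comp_phi hμ hf.1.deriv.continuousOn hz).mul
      ((ht.mul h1t).mul (hw.pow 2))).mul hw).add
      ((aestronglyMeasurable_comp_phi hμ hc hz).mul (h1t.mul (hw.pow 2)))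
  · filter_upwards [ae_mem_Ico hμ] with t ht x hx
    rw [← (hasDerivAt_T hf.1 ht (hmem x hx)).deriv]
    -- Cauchy's estimate transfers the majorant for `T_t f` to its derivative, so `f'` needs no
    -- bound of its own.
    refine Complex.norm_deriv_le_of_forall_mem_sphere_norm_le hε0 ?_ fun y hy =>
      norm_T_le hp hf ht hr1 (hnorm x hx y (Metric.sphere_subset_closedBall hy))
    refine DifferentiableOn.diffContOnCl ?_
    rw [closure_ball x hε0.ne']
    exact fun y hy => (hasDerivAt_T hf.1 ht (hsub x hx hy)).differentiableAt.differentiableWithinAt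
  · exact (hk.const_mul _).div_const _
  · filter_upwards [ae_mem_Ico hμ] with t ht x hx using hasDerivAt_T hf.1 ht (hmem x hx)

/-! ### The operator norm and positivity of real parts -/

lemma bergmanNorm_smul (p : ℝ) (c : ℂ) (f : ℂ → ℂ) :
    bergmanNorm p (c • f) = ‖c‖ₑ * bergmanNorm p f :=
  eLpNorm_const_smul _ _ _ _

lemma Gamma_smul (μ : Measure ℝ) (c : ℂ) (f : ℂ → ℂ) : Gamma μ (c • f) = c • Gamma μ f := by
  funext z
  simp only [Gamma, T, Pi.smul_apply, smul_eq_mul, mul_assoc]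
  exact integral_const_mul _ _

lemma MemBergman.smul {p : ℝ} {f : ℂ → ℂ} (hf : MemBergman p f) (c : ℂ) :
    MemBergman p (c • f) := by
  refine ⟨fun z hz => analyticAt_const.smul (hf.1 z hz), ?_⟩
  rw [bergmanNorm_smul]
  exact ENNReal.mul_lt_top (by simp) hf.2

lemma bergmanNorm_Gamma_le_gammaNorm {μ : Measure ℝ} {p : ℝ} (hΓ : GammaDefined μ p)
    {f : ℂ → ℂ} (hf : MemBergman p f) (h0 : bergmanNorm p f ≠ 0) :
    bergmanNorm p (Gamma μ f) ≤ gammaNorm μ p * bergmanNorm p f := by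
  set c : ℂ := (((bergmanNorm p f).toReal⁻¹ : ℝ) : ℂ) with hc
  have hpos : 0 < (bergmanNorm p f).toReal := ENNReal.toReal_pos h0 hf.2.ne
  have hcn : ‖c‖ₑ = (bergmanNorm p f)⁻¹ := by
    rw [hc, ← ofReal_norm, Complex.norm_real, Real.norm_of_nonneg (by positivity),
      ENNReal.ofReal_inv_of_pos hpos, ENNReal.ofReal_toReal hf.2.ne]
  have h1 : bergmanNorm p (c • f) = 1 := by
    rw [bergmanNorm_smul, hcn, ENNReal.inv_mul_cancel h0 hf.2.ne]
  have h2 : bergmanNorm p (Gamma μ (c • f)) ≤ gammaNorm μ p := by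
    rw [gammaNorm, if_pos hΓ]
    exact le_iSup₂_of_le (c • f) (hf.smul c) (le_iSup_of_le h1 le_rfl)
  rw [Gamma_smul, bergmanNorm_smul, hcn] at h2
  calc bergmanNorm p (Gamma μ f)
      = (bergmanNorm p f)⁻¹ * bergmanNorm p (Gamma μ f) * bergmanNorm p f := by
        rw [mul_right_comm, ENNReal.inv_mul_cancel h0 hf.2.ne, one_mul]
    _ ≤ _ := by gcongr

/-- The mechanism of all lower bounds: for integrands in the closed right half-plane, the integral
of the real part bounds the modulus of the integral from below. -/
lemma lintegral_ofReal_re_le {α : Type*} [MeasurableSpace α] {μ : Measure α} {h : α → ℂ}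
    (hi : Integrable h μ) (h0 : ∀ᵐ t ∂μ, 0 ≤ (h t).re) :
    ∫⁻ t, ENNReal.ofReal (h t).re ∂μ ≤ ‖∫ t, h t ∂μ‖ₑ := by
  have hre : Integrable (fun t => (h t).re) μ := hi.re
  rw [← ofReal_integral_eq_lintegral_ofReal hre h0, ← ofReal_norm]
  refine ENNReal.ofReal_le_ofReal ?_
  have : ∫ t, (h t).re ∂μ = (∫ t, h t ∂μ).re := integral_re hi
  rw [this]
  exact Complex.re_le_norm _

/-- One has `Re d^c = |d|^c cos(c arg d)`. Since `|c| ≤ 1` and `|arg d| < π/2`, the cosine is at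
least `cos(arg d) = Re d / |d|`. -/
lemma le_re_cpow {d : ℂ} (hd : 0 < d.re) {c : ℝ} (hc : |c| ≤ 1) :
    ‖d‖ ^ c * (d.re / ‖d‖) ≤ (d ^ (c : ℂ)).re := by
  have hd0 : d ≠ 0 := fun h => by simp [h] at hd
  have hn : 0 < ‖d‖ := norm_pos_iff.2 hd0
  have harg : |d.arg| < Real.pi / 2 := Complex.abs_arg_lt_pi_div_two_iff.2 (Or.inl hd)
  have e : (d ^ (c : ℂ)).re = ‖d‖ ^ c * Real.cos (c * d.arg) := by
    rw [Complex.cpow_def_of_ne_zero hd0, Complex.exp_re, Real.rpow_def_of_pos hn]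
    simp [Complex.log_re, Complex.log_im, mul_comm]
  rw [e]
  gcongr
  rw [← Complex.cos_arg hd0, ← Real.cos_abs d.arg, ← Real.cos_abs (c * d.arg)]
  refine Real.cos_le_cos_of_nonneg_of_le_pi (abs_nonneg _) (by linarith [Real.pi_pos]) ?_
  rw [abs_mul]
  exact mul_le_of_le_one_left (abs_nonneg _) hc

lemma re_cpow_nonneg {d : ℂ} (hd : 0 < d.re) {c : ℝ} (hc : |c| ≤ 1) : 0 ≤ (d ^ (c : ℂ)).re :=
  le_trans (by positivity) (le_re_cpow hd hc)

/-! ### Test functions `(1 - z)^(-a)` -/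

/-- The test function `(1 - z)^(-a)`. -/
def testFun (a : ℝ) (z : ℂ) : ℂ := (1 - z) ^ ((-a : ℝ) : ℂ)

lemma norm_testFun (a : ℝ) (z : ℂ) : ‖testFun a z‖ = ‖1 - z‖ ^ (-a) :=
  Complex.norm_cpow_real _ _

lemma one_sub_re_pos {z : ℂ} (hz : z ∈ unitDisc) : 0 < (1 - z).re := by
  simpa using re_lt_one hz

lemma one_sub_ne_zero {z : ℂ} (hz : z ∈ unitDisc) : 1 - z ≠ 0 := fun h => by
  simpa [h] using one_sub_re_pos hz

lemma analyticOnNhd_testFun (a : ℝ) : AnalyticOnNhd ℂ (testFun a) unitDisc := fun _ hz =>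
  (analyticAt_const.sub analyticAt_id).cpow analyticAt_const (Or.inl (one_sub_re_pos hz))

/-- The identity `1 - φ_t(z) = (1 - t)(1 - z) / den t z` passes to principal logarithms because `1 -
z` and `den t z` lie in the right half-plane, so their arguments differ by less than `π`. -/
lemma log_one_sub_phi {t : ℝ} (ht : t ∈ Set.Ico (0 : ℝ) 1) {z : ℂ} (hz : z ∈ unitDisc) :
    Complex.log (1 - phi t z) =
      Real.log (1 - t) + Complex.log (1 - z) - Complex.log (den t z) := by
  have h1t := sub_pos.2 ht.2
  have hd := den_ne_zero ht hz
  have hz0 := one_sub_ne_zero hz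
  have a1 : |(1 - z).arg| < Real.pi / 2 :=
    Complex.abs_arg_lt_pi_div_two_iff.2 (Or.inl (one_sub_re_pos hz))
  have a2 : |(den t z).arg| < Real.pi / 2 :=
    Complex.abs_arg_lt_pi_div_two_iff.2 (Or.inl (den_re_pos ht hz))
  have hpi : (den t z).arg ≠ Real.pi := by
    have := abs_lt.1 a2; linarith [Real.pi_pos]
  have e : 1 - phi t z = ((1 - t : ℝ) : ℂ) * ((1 - z) * (den t z)⁻¹) := by
    rw [phi_eq]
    field_simp
    rw [den]
    push_cast
    ring
  rw [e, Complex.log_ofReal_mul h1t (mul_ne_zero hz0 (inv_ne_zero hd)),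
    (Complex.log_mul_eq_add_log_iff hz0 (inv_ne_zero hd)).2, Complex.log_inv _ hpi]
  · ring
  · rw [Complex.arg_inv, if_neg hpi]
    have := abs_lt.1 a1
    have := abs_lt.1 a2
    constructor <;> linarith

/-- Approximate eigenfunction relation: `den t z → t` as `z → 1`, so the multiplier tends to
`t^(a-1) (1-t)^(-a)`, which is the kernel when `a = 2/p`. -/
lemma T_testFun (a : ℝ) {t : ℝ} (ht : t ∈ Set.Ico (0 : ℝ) 1) {z : ℂ} (hz : z ∈ unitDisc) :
    T t (testFun a) z =
      testFun a z * ((((1 - t) ^ (-a) : ℝ) : ℂ) * den t z ^ ((a - 1 : ℝ) : ℂ)) := by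
  have h1t := sub_pos.2 ht.2
  have hd := den_ne_zero ht hz
  have hz0 := one_sub_ne_zero hz
  have hφ0 := one_sub_ne_zero (phi_mem ht hz)
  have hw : weight t z = Complex.exp (-Complex.log (den t z)) := by
    rw [Complex.exp_neg, Complex.exp_log hd, weight_eq]
  rw [T, hw, testFun, testFun, Complex.cpow_def_of_ne_zero hφ0, Complex.cpow_def_of_ne_zero hz0,
    Complex.cpow_def_of_ne_zero hd, Real.rpow_def_of_pos h1t, log_one_sub_phi ht hz,
    Complex.ofReal_exp, ← Complex.exp_add, ← Complex.exp_add, ← Complex.exp_add]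
  congr 1
  push_cast
  ring

/-- For `t ≥ ε` and `|1 - z| ≤ κ ε` one has `t ≤ Re den ≤ |den| ≤ t (1 + κ)`. One factor `1 + κ` is
lost in `Re den / |den|`, the other in replacing `|den|^c` by `t^c`. -/
lemma le_re_den_cpow {κ ε : ℝ} (hκ : 0 ≤ κ) (hε : 0 < ε) {t : ℝ} (ht : t ∈ Set.Ico ε 1)
    {z : ℂ} (hz : z ∈ unitDisc) (hz1 : ‖1 - z‖ ≤ κ * ε) {c : ℝ} (hc : |c| ≤ 1) :
    ((1 + κ) ^ 2)⁻¹ * t ^ c ≤ (den t z ^ (c : ℂ)).re := by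
  have ht' : t ∈ Set.Ico (0 : ℝ) 1 := ⟨hε.le.trans ht.1, ht.2⟩
  have h0 : 0 < t := hε.trans_le ht.1
  have h1t := sub_pos.2 ht.2
  refine le_trans ?_ (le_re_cpow (den_re_pos ht' hz) hc)
  have hn := norm_den_pos ht' hz
  have hlow := le_norm_den ht' hz
  have hup : ‖den t z‖ ≤ t * (1 + κ) := by
    rw [den_eq]
    refine (norm_add_le _ _).trans ?_
    rw [norm_mul, Complex.norm_real, Real.norm_of_nonneg h0.le, ← Complex.ofReal_one,
      ← Complex.ofReal_sub, Complex.norm_real, Real.norm_of_nonneg h1t.le, Complex.ofReal_one]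
    have h1 : (1 - t) * ‖1 - z‖ ≤ ‖1 - z‖ := mul_le_of_le_one_left (norm_nonneg _) (by linarith)
    have h2 : κ * ε ≤ κ * t := mul_le_mul_of_nonneg_left ht.1 hκ
    linarith
  have hre : t ≤ (den t z).re := by
    rw [den_re]
    have := mul_pos h1t (sub_pos.2 (re_lt_one hz))
    linarith
  have h1 : (1 + κ)⁻¹ ≤ (den t z).re / ‖den t z‖ := by
    rw [le_div_iff₀ hn, inv_mul_le_iff₀ (by linarith)]
    nlinarith
  have h2 : (1 + κ)⁻¹ * t ^ c ≤ ‖den t z‖ ^ c := by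
    rcases le_total 0 c with hc0 | hc0
    · refine le_trans ?_ (Real.rpow_le_rpow h0.le hlow hc0)
      refine mul_le_of_le_one_left (by positivity) (inv_le_one_of_one_le₀ (by linarith))
    · refine le_trans ?_ (Real.rpow_le_rpow_of_nonpos hn hup hc0)
      rw [Real.mul_rpow h0.le (by linarith), mul_comm]
      gcongr
      rw [← Real.rpow_neg_one]
      exact Real.rpow_le_rpow_of_exponent_le (by linarith) (abs_le.1 hc).1
  calc ((1 + κ) ^ 2)⁻¹ * t ^ c = ((1 + κ)⁻¹ * t ^ c) * (1 + κ)⁻¹ := by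
        rw [sq, mul_inv]; ring
    _ ≤ _ := mul_le_mul h2 h1 (by positivity) (by positivity)

/-- The range `0 ≤ a ≤ 2` is `|a - 1| ≤ 1`, so every multiplier has nonnegative real part and the
parameters `t < ε` can be dropped. -/
lemma le_enorm_Gamma_testFun {p : ℝ} {μ : Measure ℝ}
    (hμ : μ (Set.Ico (0 : ℝ) 1)ᶜ = 0) (hΓ : GammaDefined μ p) {a : ℝ} (ha0 : 0 ≤ a) (ha2 : a ≤ 2)
    (hf : MemBergman p (testFun a)) {κ ε : ℝ} (hκ : 0 ≤ κ) (hε : 0 < ε)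
    {z : ℂ} (hz : z ∈ unitDisc) (hz1 : ‖1 - z‖ ≤ κ * ε) :
    ENNReal.ofReal (‖1 - z‖ ^ (-a)) * (ENNReal.ofReal ((1 + κ) ^ 2)⁻¹ *
      ∫⁻ t in Set.Ico ε 1, ENNReal.ofReal (t ^ (a - 1) * (1 - t) ^ (-a)) ∂μ) ≤
      ‖Gamma μ (testFun a) z‖ₑ := by
  have hi := (hΓ _ hf).1 z hz
  have hf0 : testFun a z ≠ 0 := by
    rw [← norm_pos_iff, norm_testFun]
    have := norm_pos_iff.2 (one_sub_ne_zero hz)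
    positivity
  set h : ℝ → ℂ := fun t => (((1 - t) ^ (-a) : ℝ) : ℂ) * den t z ^ ((a - 1 : ℝ) : ℂ) with hh
  have hTe : (fun t => T t (testFun a) z) =ᵐ[μ] fun t => testFun a z * h t := by
    filter_upwards [ae_mem_Ico hμ] with t ht using T_testFun a ht hz
  have hhi : Integrable h μ := by
    have := (hi.congr hTe).const_mul (testFun a z)⁻¹
    refine this.congr (Filter.Eventually.of_forall fun t => ?_)
    simp only [← mul_assoc, inv_mul_cancel₀ hf0, one_mul]
  have hG : Gamma μ (testFun a) z = testFun a z * ∫ t, h t ∂μ := by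
    rw [Gamma, integral_congr_ae hTe, integral_const_mul]
  have hc : |a - 1| ≤ 1 := by rw [abs_le]; constructor <;> linarith
  have hre : ∀ t, (h t).re = (1 - t) ^ (-a) * (den t z ^ ((a - 1 : ℝ) : ℂ)).re := fun t => by
    rw [hh, Complex.re_ofReal_mul]
  have h0 : ∀ᵐ t ∂μ, 0 ≤ (h t).re := by
    filter_upwards [ae_mem_Ico hμ] with t ht
    rw [hre]
    exact mul_nonneg (Real.rpow_nonneg (sub_pos.2 ht.2).le _) (re_cpow_nonneg (den_re_pos ht hz) hc)
  rw [hG, enorm_mul, ← ofReal_norm (testFun a z), norm_testFun]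
  refine mul_le_mul' le_rfl (le_trans ?_ (lintegral_ofReal_re_le hhi h0))
  rw [← lintegral_const_mul' _ _ ENNReal.ofReal_ne_top]
  refine (setLIntegral_mono' measurableSet_Ico fun t ht => ?_).trans
    (setLIntegral_le_lintegral (Set.Ico ε 1) _)
  rw [← ENNReal.ofReal_mul (by positivity), hre]
  refine ENNReal.ofReal_le_ofReal ?_
  have := le_re_den_cpow hκ hε ht hz hz1 hc
  calc ((1 + κ) ^ 2)⁻¹ * (t ^ (a - 1) * (1 - t) ^ (-a))
      = (1 - t) ^ (-a) * (((1 + κ) ^ 2)⁻¹ * t ^ (a - 1)) := by ring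
    _ ≤ _ := mul_le_mul_of_nonneg_left this (Real.rpow_nonneg (sub_pos.2 ht.2).le _)

/-- Expand `|1 - u|² = 1 - 2 Re u + |u|²` and use `2 Re u ≥ |u| > |u|²`. -/
lemma mem_unitDisc_of_sector {u : ℂ} (h0 : 0 < ‖u‖) (h1 : ‖u‖ < 1) (h2 : ‖u‖ / 2 ≤ u.re) :
    1 - u ∈ unitDisc := by
  have e : ‖1 - u‖ ^ 2 = 1 - 2 * u.re + ‖u‖ ^ 2 := by
    rw [← Complex.normSq_eq_norm_sq, ← Complex.normSq_eq_norm_sq, Complex.normSq_apply,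
      Complex.normSq_apply]
    simp
    ring
  have : ‖1 - u‖ ^ 2 < 1 ^ 2 := by rw [e]; nlinarith
  have := lt_of_pow_lt_pow_left₀ 2 zero_le_one this
  simpa [unitDisc] using this

/-- Integration over a sector of the disc with vertex `1`. -/
lemma sector_le_lintegral_areaDisc {h : ℝ → ℝ≥0∞} (hh : Measurable h) {g : ℂ → ℝ≥0∞}
    (hg : ∀ z ∈ unitDisc, ‖1 - z‖ < 1 → ‖1 - z‖ / 2 ≤ (1 - z).re → h ‖1 - z‖ ≤ g z) :
    ENNReal.ofReal (2 / 3) * ∫⁻ r in Set.Ioo (0 : ℝ) 1, ENNReal.ofReal r * h r ≤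
      ∫⁻ z, g z ∂areaDisc := by
  set S : Set ℂ := {u | 0 < ‖u‖ ∧ ‖u‖ < 1 ∧ ‖u‖ / 2 ≤ u.re} with hS
  have hSm : MeasurableSet S :=
    (measurableSet_lt measurable_const measurable_norm).inter
      ((measurableSet_lt measurable_norm measurable_const).inter
        (measurableSet_le (measurable_norm.div_const 2) Complex.measurable_re))
  set G : ℂ → ℝ≥0∞ := S.indicator fun u => h ‖u‖ with hG
  have hGm : Measurable G := (hh.comp measurable_norm).indicator hSm
  have h1 : ∫⁻ u, G u ≤ ∫⁻ z in unitDisc, g z := by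
    rw [← lintegral_indicator measurableSet_unitDisc, ← lintegral_sub_left_eq_self G (1 : ℂ)]
    refine lintegral_mono fun z => ?_
    by_cases hz : 1 - z ∈ S
    · have hzD : z ∈ unitDisc := by
        simpa using mem_unitDisc_of_sector hz.1 hz.2.1 hz.2.2
      rw [hG, Set.indicator_of_mem hz, Set.indicator_of_mem hzD]
      exact hg z hzD hz.2.1 hz.2.2
    · rw [hG, Set.indicator_of_notMem hz]
      exact zero_le
  -- The sector has half-angle `π/3`, as `cos(π/3) = 1/2`; its opening `2π/3`, divided by `π`, gives
  -- the constant `2/3`.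
  have h2 : ENNReal.ofReal (2 * Real.pi / 3) * ∫⁻ r in Set.Ioo (0 : ℝ) 1, ENNReal.ofReal r * h r ≤
      ∫⁻ u, G u := by
    rw [lintegral_polar hGm, ← lintegral_const_mul' _ _ ENNReal.ofReal_ne_top]
    refine (setLIntegral_mono' measurableSet_Ioo fun r hr => ?_).trans
      (lintegral_mono_set Set.Ioo_subset_Ioi_self)
    rw [mul_left_comm]
    refine mul_le_mul' le_rfl ?_
    have hpi := Real.pi_pos
    calc ENNReal.ofReal (2 * Real.pi / 3) * h r
        = ∫⁻ _ in Set.Ioo (-(Real.pi / 3)) (Real.pi / 3), h r := by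
          rw [setLIntegral_const, Real.volume_Ioo, mul_comm]
          congr 2
          ring
      _ ≤ ∫⁻ θ in Set.Ioo (-(Real.pi / 3)) (Real.pi / 3), G (circleMap 0 r θ) := by
          refine setLIntegral_mono' measurableSet_Ioo fun θ hθ => ?_
          have hn : ‖circleMap 0 r θ‖ = r := by rw [norm_circleMap_zero, abs_of_pos hr.1]
          have hre : (circleMap 0 r θ).re = r * Real.cos θ := by
            rw [circleMap_zero, Complex.re_ofReal_mul, Complex.exp_ofReal_mul_I_re]
          have hcos : 1 / 2 ≤ Real.cos θ := by
            rw [← Real.cos_pi_div_three, ← Real.cos_abs θ]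
            exact Real.cos_le_cos_of_nonneg_of_le_pi (abs_nonneg _) (by linarith)
              (abs_le.2 ⟨hθ.1.le, hθ.2.le⟩)
          have hm : circleMap 0 r θ ∈ S := by
            refine ⟨by rw [hn]; exact hr.1, by rw [hn]; exact hr.2, ?_⟩
            rw [hn, hre]
            nlinarith [hr.1]
          rw [hG, Set.indicator_of_mem hm, hn]
      _ ≤ _ := lintegral_mono_set (Set.Ioo_subset_Ioo (by linarith) (by linarith))
  rw [lintegral_areaDisc]
  refine le_trans (le_of_eq ?_) (mul_le_mul' le_rfl (h2.trans h1))
  rw [← mul_assoc]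
  congr 1
  rw [← ENNReal.ofReal_inv_of_pos Real.pi_pos, ← ENNReal.ofReal_mul (by positivity)]
  congr 1
  field_simp

lemma lintegral_Ioo_inv_eq_top {δ : ℝ} (hδ : 0 < δ) :
    ∫⁻ r in Set.Ioo 0 δ, ENNReal.ofReal r⁻¹ = ∞ := by
  refine ENNReal.eq_top_of_forall_nnreal_le fun x => ?_
  have ha : 0 < δ * Real.exp (-x) := by positivity
  have hle : δ * Real.exp (-x) ≤ δ :=
    mul_le_of_le_one_right hδ.le (Real.exp_le_one_iff.2 (by simp))
  have h := lintegral_Ico_inv ha hle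
  have e : Real.log (δ / (δ * Real.exp (-x))) = x := by
    rw [div_mul_cancel_left₀ hδ.ne', Real.log_inv, Real.log_exp, neg_neg]
  rw [e, ENNReal.ofReal_coe_nnreal] at h
  rw [← h]
  exact lintegral_mono_set fun r hr => ⟨ha.trans_le hr.1, hr.2⟩

/-- Divergence at the critical exponent `2`, even over small neighbourhoods of `1`, forces the test
functions to concentrate there. -/
lemma lintegral_near_one_eq_top {δ : ℝ} (hδ : 0 < δ) (hδ1 : δ ≤ 1) :
    ∫⁻ z in {z | ‖1 - z‖ ≤ δ}, ENNReal.ofReal (‖1 - z‖ ^ (-2 : ℝ)) ∂areaDisc = ∞ := by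
  have hS : MeasurableSet {z : ℂ | ‖1 - z‖ ≤ δ} :=
    measurableSet_le (measurable_const.sub measurable_id).norm measurable_const
  rw [← lintegral_indicator hS, eq_top_iff]
  refine le_trans (le_of_eq ?_) (sector_le_lintegral_areaDisc
    (h := (Set.Iic δ).indicator fun r => ENNReal.ofReal (r ^ (-2 : ℝ)))
    ((ENNReal.measurable_ofReal.comp (measurable_id.pow_const _)).indicator measurableSet_Iic)
    fun z _ _ _ => le_of_eq ?_)
  · symm
    have : ∫⁻ r in Set.Ioo (0 : ℝ) 1,
        ENNReal.ofReal r * (Set.Iic δ).indicator (fun r => ENNReal.ofReal (r ^ (-2 : ℝ))) r = ∞ := by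
      rw [eq_top_iff, ← lintegral_Ioo_inv_eq_top hδ]
      refine (setLIntegral_mono' measurableSet_Ioo fun r hr => ?_).trans
        (lintegral_mono_set (Set.Ioo_subset_Ioo_right hδ1))
      rw [Set.indicator_of_mem (Set.mem_Iic.2 hr.2.le), ← ENNReal.ofReal_mul hr.1.le]
      refine ENNReal.ofReal_le_ofReal (le_of_eq ?_)
      rw [Real.rpow_neg hr.1.le, Real.rpow_two]
      have := hr.1.ne'
      field_simp
    rw [this]
    exact ENNReal.mul_top (by simp)
  · by_cases hz : ‖1 - z‖ ≤ δ
    · rw [Set.indicator_of_mem (Set.mem_Iic.2 hz), Set.indicator_of_mem (by exact hz)]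
    · rw [Set.indicator_of_notMem (by simpa using hz), Set.indicator_of_notMem (by exact hz)]

lemma enorm_testFun_rpow {p : ℝ} (hp : 0 ≤ p) (a : ℝ) (z : ℂ) :
    ‖testFun a z‖ₑ ^ p = ENNReal.ofReal (‖1 - z‖ ^ (-(a * p))) := by
  rw [← ofReal_norm, norm_testFun, ENNReal.ofReal_rpow_of_nonneg (by positivity) hp,
    ← Real.rpow_mul (norm_nonneg _), neg_mul]

lemma memBergman_testFun {p : ℝ} (hp : 1 ≤ p) {a : ℝ} (ha : a * p < 2) :
    MemBergman p (testFun a) := by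
  refine ⟨analyticOnNhd_testFun a, ?_⟩
  rw [bergmanNorm_eq hp]
  simp_rw [enorm_testFun_rpow (show 0 ≤ p by linarith)]
  exact ENNReal.rpow_lt_top_of_nonneg (by positivity)
    (lintegral_areaDisc_one_sub_rpow_lt_top (by linarith)).ne

lemma zero_mem_unitDisc : (0 : ℂ) ∈ unitDisc := by simp [unitDisc]

lemma enorm_apply_zero_le {p : ℝ} (hp : 1 ≤ p) {f : ℂ → ℂ} (hf : AnalyticOnNhd ℂ f unitDisc) :
    ‖f 0‖ₑ ≤ bergmanNorm p f := by
  simpa using enorm_le_bergmanNorm hp hf zero_mem_unitDisc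

lemma bergmanNorm_testFun_ne_zero {p : ℝ} (hp : 1 ≤ p) (a : ℝ) :
    bergmanNorm p (testFun a) ≠ 0 := by
  have := enorm_apply_zero_le hp (analyticOnNhd_testFun a)
  intro h
  rw [h] at this
  simp [testFun] at this

/-- The mass of `|1 - z|^(-q)`, `q ≤ 2`, away from the point `1` is bounded. -/
lemma lintegral_testFun_le {q δ : ℝ} (hq0 : 0 ≤ q) (hq : q ≤ 2) (hδ : 0 < δ) (hδ1 : δ ≤ 1) :
    ∫⁻ z, ENNReal.ofReal (‖1 - z‖ ^ (-q)) ∂areaDisc ≤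
      ∫⁻ z in {z | ‖1 - z‖ ≤ δ}, ENNReal.ofReal (‖1 - z‖ ^ (-q)) ∂areaDisc +
        ENNReal.ofReal (δ ^ (-2 : ℝ)) := by
  have hS : MeasurableSet {z : ℂ | ‖1 - z‖ ≤ δ} :=
    measurableSet_le (measurable_const.sub measurable_id).norm measurable_const
  rw [← lintegral_add_compl _ hS]
  refine add_le_add le_rfl ?_
  calc _ ≤ ∫⁻ _ in {z | ‖1 - z‖ ≤ δ}ᶜ, ENNReal.ofReal (δ ^ (-2 : ℝ)) ∂areaDisc := by
        refine setLIntegral_mono' hS.compl fun z hz => ENNReal.ofReal_le_ofReal ?_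
        have hz : δ < ‖1 - z‖ := not_le.1 hz
        calc ‖1 - z‖ ^ (-q) ≤ δ ^ (-q) :=
              Real.rpow_le_rpow_of_nonpos hδ hz.le (by linarith)
          _ ≤ δ ^ (-2 : ℝ) := Real.rpow_le_rpow_of_exponent_ge hδ hδ1 (by linarith)
    _ ≤ _ := by
        rw [setLIntegral_const]
        exact mul_le_of_le_one_right' prob_le_one

/-- The basic inequality obtained by testing on `(1 - z)^(-a)`. -/
lemma testFun_inequality {p : ℝ} (hp : 1 ≤ p) {μ : Measure ℝ}
    (hμ : μ (Set.Ico (0 : ℝ) 1)ᶜ = 0) (hΓ : GammaDefined μ p) {a : ℝ} (ha0 : 0 ≤ a)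
    (ha : a * p < 2) {κ ε : ℝ} (hκ : 0 < κ) (hε : 0 < ε) (hκε : κ * ε ≤ 1) :
    (ENNReal.ofReal ((1 + κ) ^ 2)⁻¹ *
      ∫⁻ t in Set.Ico ε 1, ENNReal.ofReal (t ^ (a - 1) * (1 - t) ^ (-a)) ∂μ) ^ p *
        (∫⁻ z in {z | ‖1 - z‖ ≤ κ * ε}, ENNReal.ofReal (‖1 - z‖ ^ (-(a * p))) ∂areaDisc) ≤
      gammaNorm μ p ^ p *
        ((∫⁻ z in {z | ‖1 - z‖ ≤ κ * ε}, ENNReal.ofReal (‖1 - z‖ ^ (-(a * p))) ∂areaDisc) +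
          ENNReal.ofReal ((κ * ε) ^ (-2 : ℝ))) := by
  have hp0 : 0 ≤ p := by linarith
  have hf := memBergman_testFun hp ha
  have ha2 : a ≤ 2 := by nlinarith
  set Q := ENNReal.ofReal ((1 + κ) ^ 2)⁻¹ *
      ∫⁻ t in Set.Ico ε 1, ENNReal.ofReal (t ^ (a - 1) * (1 - t) ^ (-a)) ∂μ with hQ
  have hup : bergmanNorm p (Gamma μ (testFun a)) ^ p ≤
      gammaNorm μ p ^ p * ∫⁻ z, ENNReal.ofReal (‖1 - z‖ ^ (-(a * p))) ∂areaDisc := by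
    refine (ENNReal.rpow_le_rpow (bergmanNorm_Gamma_le_gammaNorm hΓ hf
      (bergmanNorm_testFun_ne_zero hp a)) hp0).trans_eq ?_
    rw [ENNReal.mul_rpow_of_nonneg _ _ hp0, bergmanNorm_rpow hp]
    simp_rw [enorm_testFun_rpow hp0]
  refine le_trans ?_ (hup.trans (mul_le_mul' le_rfl
    (lintegral_testFun_le (by positivity) ha.le (by positivity) hκε)))
  have hS : MeasurableSet {z : ℂ | ‖1 - z‖ ≤ κ * ε} :=
    measurableSet_le (measurable_const.sub measurable_id).norm measurable_const
  have hm : Measurable fun z : ℂ => ENNReal.ofReal (‖1 - z‖ ^ (-(a * p))) := by fun_prop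
  rw [bergmanNorm_rpow hp, ← lintegral_indicator hS, ← lintegral_const_mul _ (hm.indicator hS)]
  refine lintegral_mono_ae (ae_areaDisc_of_forall fun z hz => ?_)
  by_cases hzS : ‖1 - z‖ ≤ κ * ε
  · rw [Set.indicator_of_mem (by exact hzS)]
    have := ENNReal.rpow_le_rpow (le_enorm_Gamma_testFun hμ hΓ ha0 ha2 hf hκ.le hε hz hzS) hp0
    refine le_trans (le_of_eq ?_) this
    rw [ENNReal.mul_rpow_of_nonneg (ENNReal.ofReal (‖1 - z‖ ^ (-a))) _ hp0,
      ENNReal.ofReal_rpow_of_nonneg (by positivity) hp0, ← Real.rpow_mul (norm_nonneg _), neg_mul,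
      mul_comm]
  · rw [Set.indicator_of_notMem (by exact hzS), mul_zero]
    exact zero_le

/-! ### The sharp lower bound as `a → 2/p` -/

lemma tendsto_exponent (α : ℝ) : Tendsto (fun n : ℕ => α * (1 - 1 / ((n : ℝ) + 1))) atTop (𝓝 α) := by
  have := (tendsto_one_div_add_atTop_nhds_zero_nat (𝕜 := ℝ)).const_sub 1 |>.const_mul α
  simpa using this

/-- Fatou's lemma; no `μ`-integrability of the limit kernel is known at this stage. -/
lemma kernel_le_of_tendsto {μ : Measure ℝ} {α ε : ℝ} (hε : 0 < ε) {a : ℕ → ℝ}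
    (ha : Tendsto a atTop (𝓝 α)) :
    ∫⁻ t in Set.Ico ε 1, ENNReal.ofReal (t ^ (α - 1) * (1 - t) ^ (-α)) ∂μ ≤
      liminf (fun n => ∫⁻ t in Set.Ico ε 1,
        ENNReal.ofReal (t ^ (a n - 1) * (1 - t) ^ (-a n)) ∂μ) atTop := by
  refine le_trans (le_of_eq ?_) (lintegral_liminf_le fun n => by fun_prop)
  refine setLIntegral_congr_fun measurableSet_Ico fun t ht => ?_
  have h0 : 0 < t := hε.trans_le ht.1
  have h1t := sub_pos.2 ht.2
  refine (Tendsto.liminf_eq (ENNReal.tendsto_ofReal (Tendsto.mul ?_ ?_))).symm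
  · exact (Real.continuousAt_const_rpow h0.ne').tendsto.comp (ha.sub_const 1)
  · exact (Real.continuousAt_const_rpow h1t.ne').tendsto.comp ha.neg

lemma tendsto_mass_near_one {δ : ℝ} (hδ : 0 < δ) (hδ1 : δ ≤ 1) {q : ℕ → ℝ}
    (hq : Tendsto q atTop (𝓝 2)) :
    Tendsto (fun n => ∫⁻ z in {z | ‖1 - z‖ ≤ δ}, ENNReal.ofReal (‖1 - z‖ ^ (-q n)) ∂areaDisc)
      atTop (𝓝 ∞) := by
  refine tendsto_of_le_liminf_of_limsup_le ?_ le_top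
  rw [← lintegral_near_one_eq_top hδ hδ1]
  refine le_trans (lintegral_mono_ae ?_) (lintegral_liminf_le fun n => by fun_prop)
  refine ae_restrict_of_ae (ae_areaDisc_of_forall fun z hz => ?_)
  refine (Tendsto.liminf_eq (ENNReal.tendsto_ofReal ?_)).ge
  exact (Real.continuousAt_const_rpow (norm_pos_iff.2 (one_sub_ne_zero hz)).ne').tendsto.comp hq.neg

/-- Divide by `Y n`: the error `D / Y n` vanishes, so the mass away from `1` does not affect the
limit. -/
lemma le_of_mul_rpow_le {p : ℝ} (hp : 0 < p) {x N D : ℝ≥0∞} (hN : N ≠ ∞) (hD : D ≠ ∞)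
    {Q Y : ℕ → ℝ≥0∞} (hx : x ≤ liminf Q atTop) (hY : Tendsto Y atTop (𝓝 ∞))
    (hYfin : ∀ n, Y n ≠ ∞) (h : ∀ n, Q n ^ p * Y n ≤ N ^ p * (Y n + D)) : x ≤ N := by
  refine le_of_forall_lt_imp_le_of_dense fun y hy => ?_
  have h1 : ∀ᶠ n in atTop, y < Q n := eventually_lt_of_lt_liminf (hy.trans_le hx)
  have h2 : Tendsto (fun n => N ^ p * (1 + D / Y n)) atTop (𝓝 (N ^ p * (1 + D / ∞))) :=
    ENNReal.Tendsto.const_mul (tendsto_const_nhds.add (ENNReal.Tendsto.const_div hY (Or.inr hD)))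
      (Or.inr (ENNReal.rpow_ne_top_of_nonneg hp.le hN))
  rw [ENNReal.div_top, add_zero, mul_one] at h2
  have h3 : y ^ p ≤ N ^ p := by
    refine ge_of_tendsto h2 ?_
    filter_upwards [h1, (tendsto_order.1 hY).1 0 ENNReal.zero_lt_top] with n hn hn0
    have e : N ^ p * (1 + D / Y n) = N ^ p * (Y n + D) / Y n := by
      rw [mul_div_assoc, ENNReal.add_div, ENNReal.div_self hn0.ne' (hYfin n)]
    rw [e, ENNReal.le_div_iff_mul_le (Or.inl hn0.ne') (Or.inl (hYfin n))]
    exact le_trans (by gcongr) (h n)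
  exact (ENNReal.rpow_le_rpow_iff hp).1 h3

/-- For fixed `κ`, letting `a → 2/p` gives the bound with an extra factor `(1 + κ)²`; then `κ =
1/(m+1) → 0` removes it, and the constant is exactly `1`. -/
lemma kernel_Ico_le_gammaNorm {p : ℝ} (hp : 1 ≤ p) {μ : Measure ℝ}
    (hμ : μ (Set.Ico (0 : ℝ) 1)ᶜ = 0) (hΓ : GammaDefined μ p) (hN : gammaNorm μ p ≠ ∞)
    {ε : ℝ} (hε : 0 < ε) (hε1 : ε ≤ 1) :
    ∫⁻ t in Set.Ico ε 1, kernelTheta p t ∂μ ≤ gammaNorm μ p := by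
  have hp0 : 0 < p := by linarith
  have hα : 2 / p * p = 2 := div_mul_cancel₀ _ hp0.ne'
  have hK : ∫⁻ t in Set.Ico ε 1, kernelTheta p t ∂μ =
      ∫⁻ t in Set.Ico ε 1, ENNReal.ofReal (t ^ (2 / p - 1) * (1 - t) ^ (-(2 / p))) ∂μ := by
    refine setLIntegral_congr_fun measurableSet_Ico fun t ht => ?_
    rw [kernelTheta_eq ⟨hε.trans_le ht.1, ht.2⟩, Real.rpow_neg (sub_pos.2 ht.2).le, div_eq_mul_inv]
  set a : ℕ → ℝ := fun n => 2 / p * (1 - 1 / ((n : ℝ) + 1)) with ha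
  have hat : Tendsto a atTop (𝓝 (2 / p)) := tendsto_exponent _
  have hn : ∀ n : ℕ, 0 < 1 / ((n : ℝ) + 1) ∧ 1 / ((n : ℝ) + 1) ≤ 1 := fun n =>
    ⟨by positivity, by rw [div_le_one (by positivity)]; linarith [(Nat.cast_nonneg n : (0 : ℝ) ≤ n)]⟩
  have ha0 : ∀ n, 0 ≤ a n := fun n => mul_nonneg (by positivity) (sub_nonneg.2 (hn n).2)
  have ha2 : ∀ n, a n * p < 2 := fun n => by
    rw [ha, mul_right_comm, hα]
    linarith [(hn n).1]
  have hap : Tendsto (fun n => a n * p) atTop (𝓝 2) := by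
    simpa only [hα] using hat.mul_const p
  have key : ∀ n : ℕ, ∫⁻ t in Set.Ico ε 1, kernelTheta p t ∂μ ≤
      gammaNorm μ p * ENNReal.ofReal ((1 + 1 / ((n : ℝ) + 1)) ^ 2) := by
    intro m
    obtain ⟨hκ, hκ1⟩ := hn m
    set κ := 1 / ((m : ℝ) + 1)
    have hκε : κ * ε ≤ 1 := mul_le_one₀ hκ1 hε.le hε1
    have hc : ENNReal.ofReal ((1 + κ) ^ 2) * ENNReal.ofReal ((1 + κ) ^ 2)⁻¹ = 1 := by
      rw [← ENNReal.ofReal_mul (by positivity), mul_inv_cancel₀ (by positivity), ENNReal.ofReal_one]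
    rw [hK]
    refine le_of_mul_rpow_le hp0 (ENNReal.mul_ne_top hN ENNReal.ofReal_ne_top)
      (D := ENNReal.ofReal ((κ * ε) ^ (-2 : ℝ))) ENNReal.ofReal_ne_top
      (kernel_le_of_tendsto hε hat) (tendsto_mass_near_one (mul_pos hκ hε) hκε hap)
      (fun n => ?_) (fun n => ?_)
    · refine ne_top_of_le_ne_top (lintegral_areaDisc_one_sub_rpow_lt_top
        (q := -(a n * p)) (by linarith [ha2 n])).ne (setLIntegral_le_lintegral _ _)
    · have h := testFun_inequality hp hμ hΓ (ha0 n) (ha2 n) hκ hε hκε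
      have h' := mul_le_mul' (le_refl (ENNReal.ofReal ((1 + κ) ^ 2) ^ p)) h
      rw [← mul_assoc, ← ENNReal.mul_rpow_of_nonneg _ _ hp0.le, ← mul_assoc, hc, one_mul,
        ← mul_assoc, ← ENNReal.mul_rpow_of_nonneg _ _ hp0.le, mul_comm _ (gammaNorm μ p)] at h'
      exact h'
  have hlim : Tendsto (fun n : ℕ => gammaNorm μ p * ENNReal.ofReal ((1 + 1 / ((n : ℝ) + 1)) ^ 2))
      atTop (𝓝 (gammaNorm μ p * ENNReal.ofReal ((1 + 0) ^ 2))) :=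
    ENNReal.Tendsto.const_mul (ENNReal.tendsto_ofReal
      ((tendsto_one_div_add_atTop_nhds_zero_nat.const_add 1).pow 2)) (Or.inr hN)
  have := ge_of_tendsto' hlim key
  simpa using this

lemma kernel_Ioo_le_gammaNorm {p : ℝ} (hp : 1 ≤ p) {μ : Measure ℝ}
    (hμ : μ (Set.Ico (0 : ℝ) 1)ᶜ = 0) (hΓ : GammaDefined μ p) (hN : gammaNorm μ p ≠ ∞) :
    ∫⁻ t in Set.Ioo 0 1, kernelTheta p t ∂μ ≤ gammaNorm μ p := by
  have hU : Set.Ioo (0 : ℝ) 1 = ⋃ n : ℕ, Set.Ico (1 / ((n : ℝ) + 1)) 1 := by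
    ext t
    simp only [Set.mem_Ioo, Set.mem_iUnion, Set.mem_Ico]
    constructor
    · rintro ⟨h0, h1⟩
      obtain ⟨n, hn⟩ := exists_nat_one_div_lt h0
      exact ⟨n, hn.le, h1⟩
    · rintro ⟨n, hn, h1⟩
      exact ⟨lt_of_lt_of_le (by positivity) hn, h1⟩
  have hmono : Monotone fun n : ℕ => Set.Ico (1 / ((n : ℝ) + 1)) 1 := fun m n hmn =>
    Set.Ico_subset_Ico_left (one_div_le_one_div_of_le (by positivity) (by gcongr))
  rw [hU, setLIntegral_iUnion_of_directed _ hmono.directed_le]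
  refine iSup_le fun n => kernel_Ico_le_gammaNorm hp hμ hΓ hN (by positivity) ?_
  rw [div_le_one (by positivity)]
  linarith [(Nat.cast_nonneg n : (0 : ℝ) ≤ n)]

/-! ### The constant test function and atoms at the origin -/

lemma bergmanNorm_one {p : ℝ} (hp : 1 ≤ p) : bergmanNorm p (fun _ => 1) = 1 := by
  simp [bergmanNorm_eq hp]

lemma memBergman_one {p : ℝ} (hp : 1 ≤ p) : MemBergman p (fun _ => 1) :=
  ⟨fun _ _ => analyticAt_const, by simp [bergmanNorm_one hp]⟩

lemma bergmanNorm_Gamma_one_le {p : ℝ} (hp : 1 ≤ p) {μ : Measure ℝ} (hΓ : GammaDefined μ p) :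
    bergmanNorm p (Gamma μ fun _ => 1) ≤ gammaNorm μ p := by
  have := bergmanNorm_Gamma_le_gammaNorm hΓ (memBergman_one hp) (by simp [bergmanNorm_one hp])
  rwa [bergmanNorm_one hp, mul_one] at this

lemma weight_re {t : ℝ} (z : ℂ) : (weight t z).re = (den t z).re / ‖den t z‖ ^ 2 := by
  rw [weight_eq, Complex.inv_re, Complex.normSq_eq_norm_sq]

lemma weight_re_nonneg {t : ℝ} (ht : t ∈ Set.Ico (0 : ℝ) 1) {z : ℂ} (hz : z ∈ unitDisc) :
    0 ≤ (weight t z).re := by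
  rw [weight_re]
  have := den_re_pos ht hz
  positivity

lemma lintegral_weight_re_le {p : ℝ} (hp : 1 ≤ p) {μ : Measure ℝ}
    (hμ : μ (Set.Ico (0 : ℝ) 1)ᶜ = 0) (hΓ : GammaDefined μ p) {z : ℂ} (hz : z ∈ unitDisc) :
    ∫⁻ t, ENNReal.ofReal (weight t z).re ∂μ ≤ ‖Gamma μ (fun _ => 1) z‖ₑ := by
  have hi := (hΓ _ (memBergman_one hp)).1 z hz
  simp only [T, one_mul] at hi
  simp only [Gamma, T, one_mul]
  refine lintegral_ofReal_re_le hi ?_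
  filter_upwards [ae_mem_Ico hμ] with t ht using weight_re_nonneg ht hz

/-- Evaluate at the origin: `Γ_μ 1 (0)` is the total mass of `μ`, and evaluation at `0` has norm at
most `1`. -/
lemma one_le_gammaNorm {p : ℝ} (hp : 1 ≤ p) {μ : Measure ℝ} [IsProbabilityMeasure μ]
    (hΓ : GammaDefined μ p) : 1 ≤ gammaNorm μ p := by
  refine le_trans ?_ ((enorm_apply_zero_le hp (hΓ _ (memBergman_one hp)).2).trans
    (bergmanNorm_Gamma_one_le hp hΓ))
  simp [Gamma, T, weight]

/-- For `p > 2` a bounded `Γ_μ` excludes an atom of `μ` at the origin. -/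
lemma measure_zero_eq_zero {p : ℝ} (hp : 2 < p) {μ : Measure ℝ} [IsProbabilityMeasure μ]
    (hμ : μ (Set.Ico (0 : ℝ) 1)ᶜ = 0) (hΓ : GammaDefined μ p) (hN : gammaNorm μ p ≠ ∞) :
    μ {0} = 0 := by
  have hp1 : 1 ≤ p := by linarith
  have hexp : 0 < 1 - 2 / p := by rw [sub_pos, div_lt_one (by linarith)]; exact hp
  -- Evaluate `Γ_μ 1` at `z = 1 - s`. An atom at `0` contributes `μ {0} / s`, but point evaluation
  -- allows growth only `s^(-2/p)`, which is slower because `p > 2`.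
  have key : ∀ s : ℝ, s ∈ Set.Ioo (0 : ℝ) 1 →
      μ {0} ≤ gammaNorm μ p * ENNReal.ofReal s ^ (1 - 2 / p) := by
    intro s hs
    have hn : ‖((1 - s : ℝ) : ℂ)‖ = 1 - s := by
      rw [Complex.norm_real, Real.norm_of_nonneg (sub_pos.2 hs.2).le]
    have hz : ((1 - s : ℝ) : ℂ) ∈ unitDisc := by
      simp only [unitDisc, Metric.mem_ball, dist_zero_right, hn]
      linarith [hs.1]
    have h1 := lintegral_weight_re_le hp1 hμ hΓ hz
    have h2 := (enorm_le_bergmanNorm hp1 (hΓ _ (memBergman_one hp1)).2 hz).trans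
      (mul_le_mul' le_rfl (bergmanNorm_Gamma_one_le hp1 hΓ))
    rw [hn, sub_sub_cancel] at h2
    have h3 : ENNReal.ofReal s⁻¹ * μ {0} ≤ ∫⁻ t, ENNReal.ofReal (weight t ((1 - s : ℝ) : ℂ)).re ∂μ := by
      refine le_trans (le_of_eq ?_) (setLIntegral_le_lintegral {0} _)
      rw [lintegral_singleton]
      congr 2
      rw [weight_re]
      have : den 0 ((1 - s : ℝ) : ℂ) = (s : ℂ) := by simp [den]
      rw [this, Complex.ofReal_re, Complex.norm_real, Real.norm_of_nonneg hs.1.le]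
      have := hs.1.ne'
      field_simp
    have hs0 : ENNReal.ofReal s ≠ 0 := by simpa using hs.1
    calc μ {0} = ENNReal.ofReal s * (ENNReal.ofReal s⁻¹ * μ {0}) := by
          rw [← mul_assoc, ENNReal.ofReal_inv_of_pos hs.1,
            ENNReal.mul_inv_cancel hs0 ENNReal.ofReal_ne_top, one_mul]
      _ ≤ ENNReal.ofReal s * (ENNReal.ofReal s ^ (-(2 / p)) * gammaNorm μ p) := by
          exact mul_le_mul' le_rfl (h3.trans (h1.trans h2))
      _ = _ := by
          rw [← mul_assoc, mul_comm]
          congr 1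
          nth_rewrite 1 [← ENNReal.rpow_one (ENNReal.ofReal s)]
          rw [← ENNReal.rpow_add _ _ hs0 ENNReal.ofReal_ne_top]
          rfl
  have hlim : Tendsto (fun s : ℝ => gammaNorm μ p * ENNReal.ofReal s ^ (1 - 2 / p)) (𝓝[>] 0)
      (𝓝 (gammaNorm μ p * ENNReal.ofReal 0 ^ (1 - 2 / p))) := by
    refine ENNReal.Tendsto.const_mul ?_ (Or.inr hN)
    have : Continuous fun s : ℝ => ENNReal.ofReal s ^ (1 - 2 / p) :=
      ENNReal.continuous_rpow_const.comp ENNReal.continuous_ofReal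
    exact this.continuousWithinAt
  rw [ENNReal.ofReal_zero, ENNReal.zero_rpow_of_pos hexp, mul_zero] at hlim
  refine le_antisymm (ge_of_tendsto hlim ?_) zero_le
  filter_upwards [Ioo_mem_nhdsGT zero_lt_one] with s hs using key s hs

lemma lintegral_kernelTheta_le_gammaNorm {p : ℝ} (hp : 2 < p) {μ : Measure ℝ}
    [IsProbabilityMeasure μ] (hμ : μ (Set.Ico (0 : ℝ) 1)ᶜ = 0) :
    ∫⁻ t, kernelTheta p t ∂μ ≤ gammaNorm μ p := by
  by_cases hN : gammaNorm μ p = ∞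
  · rw [hN]; exact le_top
  have hΓ : GammaDefined μ p := by
    by_contra h
    exact hN (by rw [gammaNorm, if_neg h])
  have h0 := measure_zero_eq_zero hp hμ hΓ hN
  have : μ.restrict (Set.Ioo 0 1) = μ := by
    refine Measure.restrict_eq_self_of_ae_mem ?_
    have h0' : ∀ᵐ t ∂μ, t ≠ 0 := by rw [ae_iff]; simpa using h0
    filter_upwards [ae_mem_Ico hμ, h0'] with t ht ht0 using ⟨ht.1.lt_of_ne' ht0, ht.2⟩
  calc _ = ∫⁻ t in Set.Ioo 0 1, kernelTheta p t ∂μ := by rw [this]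
    _ ≤ _ := kernel_Ioo_le_gammaNorm (by linarith) hμ hΓ hN

/-! ### Lower bounds for `p ≤ 2` -/

lemma outer_kernel_le_four {p t : ℝ} (hp : 1 ≤ p) (ht : t ≤ 1 / 2) :
    1 / ENNReal.ofReal (1 - t) ^ (2 / p) ≤ 4 := by
  have hα : 2 / p ≤ 2 := div_le_self (by norm_num) hp
  rw [one_div, ← ENNReal.inv_rpow]
  have h : (ENNReal.ofReal (1 - t))⁻¹ ≤ 2 := by
    rw [ENNReal.inv_le_iff_inv_le, ← ENNReal.ofReal_ofNat, ← ENNReal.ofReal_inv_of_pos (by norm_num)]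
    exact ENNReal.ofReal_le_ofReal (by norm_num at ht ⊢; linarith)
  calc _ ≤ (2 : ℝ≥0∞) ^ (2 / p) := ENNReal.rpow_le_rpow h (by positivity)
    _ ≤ 2 ^ (2 : ℝ) := ENNReal.rpow_le_rpow_of_exponent_le (by norm_num) hα
    _ = 4 := by norm_num

lemma outer_kernel_le_two_mul {p t : ℝ} (hp : 1 ≤ p) (ht : t ∈ Set.Ico (1 / 2 : ℝ) 1) :
    1 / ENNReal.ofReal (1 - t) ^ (2 / p) ≤ 2 * kernelTheta p t := by
  have hα : 2 / p ≤ 2 := div_le_self (by norm_num) hp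
  have h0 : 0 < t := by linarith [ht.1]
  have h1t := sub_pos.2 ht.2
  rw [kernelTheta_eq ⟨h0, ht.2⟩, ENNReal.ofReal_rpow_of_pos h1t, ← ENNReal.ofReal_one,
    ← ENNReal.ofReal_div_of_pos (by positivity), ← ENNReal.ofReal_ofNat,
    ← ENNReal.ofReal_mul (by norm_num), ← mul_div_assoc]
  refine ENNReal.ofReal_le_ofReal ?_
  gcongr
  have h2 : t ≤ t ^ (2 / p - 1) := by
    nth_rewrite 1 [← Real.rpow_one t]
    exact Real.rpow_le_rpow_of_exponent_ge h0 ht.2.le (by linarith)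
  linarith [ht.1]

/-- On `[0, 1/2]` the integrand is at most `4 ≤ 4 ‖Γ_μ‖`. On `[1/2, 1)` it is at most twice
`kernelTheta`, since `t^(2/p-1) ≥ t ≥ 1/2`, and the sharp bound applies. -/
lemma lintegral_outer_kernel_le {p : ℝ} (hp : 1 ≤ p) {μ : Measure ℝ}
    [IsProbabilityMeasure μ] (hμ : μ (Set.Ico (0 : ℝ) 1)ᶜ = 0) (hΓ : GammaDefined μ p)
    (hN : gammaNorm μ p ≠ ∞) :
    ∫⁻ t, 1 / ENNReal.ofReal (1 - t) ^ (2 / p) ∂μ ≤ 6 * gammaNorm μ p := by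
  have hm : Measurable fun t : ℝ => (Set.Ico (1 / 2 : ℝ) 1).indicator (kernelTheta p) t :=
    (measurable_kernelTheta p).indicator measurableSet_Ico
  calc _ ≤ ∫⁻ t, (4 + 2 * (Set.Ico (1 / 2 : ℝ) 1).indicator (kernelTheta p) t) ∂μ := by
        refine lintegral_mono_ae ?_
        filter_upwards [ae_mem_Ico hμ] with t ht
        rcases le_total t (1 / 2) with h | h
        · exact le_add_right (outer_kernel_le_four hp h)
        · rw [Set.indicator_of_mem (show t ∈ Set.Ico (1 / 2 : ℝ) 1 from ⟨h, ht.2⟩)]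
          exact le_add_left (outer_kernel_le_two_mul hp ⟨h, ht.2⟩)
    _ = 4 * 1 + 2 * ∫⁻ t in Set.Ico (1 / 2 : ℝ) 1, kernelTheta p t ∂μ := by
        rw [lintegral_add_left measurable_const, lintegral_const_mul _ hm,
          lintegral_indicator measurableSet_Ico, lintegral_const, measure_univ]
    _ ≤ 4 * gammaNorm μ p + 2 * gammaNorm μ p := by
        gcongr
        · exact one_le_gammaNorm hp hΓ
        · exact kernel_Ico_le_gammaNorm hp hμ hΓ hN (by norm_num) (by norm_num)
    _ = _ := by rw [← add_mul]; norm_num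

/-- In the sector `Re den ≥ |den| / 2`, so `Re w_t ≥ 1 / (2 |den|)`, and `|den| ≤ t + |1 - z|`. -/
lemma inv_le_weight_re {t : ℝ} (ht : t ∈ Set.Ico (0 : ℝ) 1) {z : ℂ} (hz : z ∈ unitDisc)
    (hs : ‖1 - z‖ / 2 ≤ (1 - z).re) : (2 * (t + ‖1 - z‖))⁻¹ ≤ (weight t z).re := by
  have h1t := sub_pos.2 ht.2
  have hn := norm_den_pos ht hz
  have hup : ‖den t z‖ ≤ t + (1 - t) * ‖1 - z‖ := by
    rw [den_eq]
    refine (norm_add_le _ _).trans_eq ?_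
    rw [norm_mul, Complex.norm_real, Real.norm_of_nonneg ht.1, ← Complex.ofReal_one,
      ← Complex.ofReal_sub, Complex.norm_real, Real.norm_of_nonneg h1t.le]
  have hup2 : ‖den t z‖ ≤ t + ‖1 - z‖ := by nlinarith [norm_nonneg (1 - z), ht.1]
  have hre : ‖den t z‖ / 2 ≤ (den t z).re := by
    have e : (den t z).re = t + (1 - t) * (1 - z).re := by rw [den_re]; simp
    rw [e]
    have := mul_le_mul_of_nonneg_left hs h1t.le
    linarith [ht.1]
  rw [weight_re]
  calc (2 * (t + ‖1 - z‖))⁻¹ ≤ (2 * ‖den t z‖)⁻¹ := inv_anti₀ (by positivity) (by linarith)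
    _ = (‖den t z‖ / 2) / ‖den t z‖ ^ 2 := by field_simp
    _ ≤ _ := by gcongr

/-- Integrate over the sector and keep only `r ≥ t`, where `r (2(t + r))⁻² ≥ 1/(16 r)`; the integral
over `[t, 1)` gives `log (1/t)`. The `24` satisfies `24 · (2/3) · (1/16) = 1`, and the added `1` is
`log e`. For `t = 0` the integral diverges, matching `logE 0 = ∞`. -/
lemma logE_le_lintegral_weight_re {t s : ℝ} (ht : t ∈ Set.Ico (0 : ℝ) 1)
    (hs : s ∈ Set.Ico (0 : ℝ) 1) (hst : s ≤ t) :
    logE t ≤ 1 + 24 * ∫⁻ z, ENNReal.ofReal (weight t z).re * ENNReal.ofReal (weight s z).re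
      ∂areaDisc := by
  set J := ∫⁻ z, ENNReal.ofReal (weight t z).re * ENNReal.ofReal (weight s z).re ∂areaDisc
  have h1 : ENNReal.ofReal (2 / 3) * ∫⁻ r in Set.Ioo (0 : ℝ) 1, ENNReal.ofReal r *
      ENNReal.ofReal ((2 * (t + r))⁻¹ ^ 2) ≤ J := by
    refine sector_le_lintegral_areaDisc (h := fun r => ENNReal.ofReal ((2 * (t + r))⁻¹ ^ 2))
      (by fun_prop) fun z hz _ hz2 => ?_
    have ht0 := ht.1
    have hs0 := hs.1
    have hpos : 0 < ‖1 - z‖ := norm_pos_iff.2 (one_sub_ne_zero hz)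
    rw [← ENNReal.ofReal_mul (weight_re_nonneg ht hz), sq]
    refine ENNReal.ofReal_le_ofReal (mul_le_mul (inv_le_weight_re ht hz hz2)
      (le_trans ?_ (inv_le_weight_re hs hz hz2)) (by positivity) (weight_re_nonneg ht hz))
    exact inv_anti₀ (by positivity) (by linarith)
  have h2 : ∀ S : Set ℝ, MeasurableSet S → S ⊆ Set.Ioo 0 1 → S ⊆ Set.Ici t →
      ENNReal.ofReal (1 / 16) * ∫⁻ r in S, ENNReal.ofReal r⁻¹ ≤
      ∫⁻ r in Set.Ioo (0 : ℝ) 1, ENNReal.ofReal r * ENNReal.ofReal ((2 * (t + r))⁻¹ ^ 2) := by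
    intro S hS hS1 hSt
    rw [← lintegral_const_mul' _ _ ENNReal.ofReal_ne_top]
    refine (setLIntegral_mono' hS fun r hr => ?_).trans (lintegral_mono_set hS1)
    have hr0 := (hS1 hr).1
    have hrt : t ≤ r := hSt hr
    have ht0 := ht.1
    rw [← ENNReal.ofReal_mul (by norm_num), ← ENNReal.ofReal_mul hr0.le]
    refine ENNReal.ofReal_le_ofReal ?_
    calc 1 / 16 * r⁻¹ = r * (4 * r)⁻¹ ^ 2 := by field_simp; norm_num
      _ ≤ r * (2 * (t + r))⁻¹ ^ 2 := by
        refine mul_le_mul_of_nonneg_left (pow_le_pow_left₀ (by positivity)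
          (inv_anti₀ (by positivity) (by linarith)) 2) hr0.le
  rcases ht.1.eq_or_lt with h0 | h0
  · have h3 := h2 (Set.Ioo 0 1) measurableSet_Ioo le_rfl fun r hr => by
      rw [← h0]; exact hr.1.le
    rw [lintegral_Ioo_inv_eq_top one_pos, ENNReal.mul_top (by simp), top_le_iff] at h3
    rw [h3, ENNReal.mul_top (by simp), top_le_iff] at h1
    rw [h1, ENNReal.mul_top (by simp), add_top]
    exact le_top
  · have h3 := h2 (Set.Ico t 1) measurableSet_Ico (fun r hr => ⟨h0.trans_le hr.1, hr.2⟩)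
      (fun r hr => hr.1)
    rw [lintegral_Ico_inv h0 ht.2.le] at h3
    have h4 := (mul_le_mul' (le_refl (ENNReal.ofReal (2 / 3))) h3).trans h1
    have hlog : Real.log t ≤ 0 := Real.log_nonpos h0.le ht.2.le
    have h5 := add_le_add (le_refl (1 : ℝ≥0∞)) (mul_le_mul' (le_refl (24 : ℝ≥0∞)) h4)
    refine le_trans (le_of_eq ?_) h5
    rw [logE_eq h0, one_div t, Real.log_inv, ← ENNReal.ofReal_mul (by norm_num),
      ← ENNReal.ofReal_mul (by norm_num), ← ENNReal.ofReal_ofNat 24,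
      ← ENNReal.ofReal_mul (by norm_num), ← ENNReal.ofReal_one,
      ← ENNReal.ofReal_add (by norm_num) (by linarith)]
    congr 1
    ring

/-- Tests on the constant `1`: its image dominates `∫ Re w_t dμ`, whose squared norm is a double
integral of pairings controlling `log (e / max(s, t))`. The additive `1` is absorbed by `‖Γ_μ‖ ≥ 1`,
so `25 = 1 + 24`. -/
lemma logEnergy_le {μ : Measure ℝ} [IsProbabilityMeasure μ]
    (hμ : μ (Set.Ico (0 : ℝ) 1)ᶜ = 0) (hΓ : GammaDefined μ 2) :
    logEnergy μ ≤ 25 * gammaNorm μ 2 ^ 2 := by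
  have hw : Measurable fun q : ℂ × ℝ => ENNReal.ofReal (weight q.2 q.1).re :=
    ENNReal.measurable_ofReal.comp (Complex.measurable_re.comp measurable_weight)
  have h1 : ∫⁻ t, ∫⁻ s, ∫⁻ z, ENNReal.ofReal (weight t z).re * ENNReal.ofReal (weight s z).re
      ∂areaDisc ∂μ ∂μ ≤ gammaNorm μ 2 ^ 2 := by
    rw [← lintegral_sq_lintegral (ν := areaDisc) hw]
    calc _ ≤ ∫⁻ z, ‖Gamma μ (fun _ => 1) z‖ₑ ^ (2 : ℝ) ∂areaDisc := by
          refine lintegral_mono_ae (ae_areaDisc_of_forall fun z hz => ?_)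
          exact ENNReal.rpow_le_rpow (lintegral_weight_re_le one_le_two hμ hΓ hz) (by norm_num)
      _ = bergmanNorm 2 (Gamma μ fun _ => 1) ^ (2 : ℝ) := (bergmanNorm_rpow one_le_two _).symm
      _ ≤ gammaNorm μ 2 ^ (2 : ℝ) :=
          ENNReal.rpow_le_rpow (bergmanNorm_Gamma_one_le one_le_two hΓ) (by norm_num)
      _ = _ := ENNReal.rpow_two _
  have h2 : 2 * logEnergy μ ≤ 2 * (1 + 24 * ∫⁻ t, ∫⁻ s, ∫⁻ z, ENNReal.ofReal (weight t z).re *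
      ENNReal.ofReal (weight s z).re ∂areaDisc ∂μ ∂μ) := by
    rw [← lintegral_logE_triangle_add hμ]
    have e : ∀ F : ℝ → ℝ → ℝ≥0∞, 2 * (1 + 24 * ∫⁻ t, ∫⁻ s, F t s ∂μ ∂μ) =
        ∫⁻ t, ∫⁻ s, 2 * (1 + 24 * F t s) ∂μ ∂μ := fun F => by
      simp_rw [lintegral_const_mul' _ _ (show (2 : ℝ≥0∞) ≠ ∞ by simp),
        lintegral_add_left measurable_const, lintegral_const_mul' _ _ (show (24 : ℝ≥0∞) ≠ ∞ by simp),
        lintegral_const, measure_univ, mul_one]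
    rw [e]
    refine lintegral_mono_ae ?_
    filter_upwards [ae_mem_Ico hμ] with t ht
    refine lintegral_mono_ae ?_
    filter_upwards [ae_mem_Ico hμ] with s hs
    rw [two_mul]
    refine add_le_add ?_ ?_
    · by_cases h : s ≤ t
      · rw [Set.indicator_of_mem (by exact h)]
        exact logE_le_lintegral_weight_re ht hs h
      · rw [Set.indicator_of_notMem (by exact h)]
        exact zero_le
    · by_cases h : t ≤ s
      · rw [Set.indicator_of_mem (by exact h)]
        simp_rw [mul_comm (ENNReal.ofReal (weight t _).re)]
        exact logE_le_lintegral_weight_re hs ht h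
      · rw [Set.indicator_of_notMem (by exact h)]
        exact zero_le
  have h3 := (ENNReal.mul_le_mul_iff_right (by simp) (by simp)).1 h2
  have h4 : (1 : ℝ≥0∞) ≤ gammaNorm μ 2 ^ 2 := one_le_pow₀ (one_le_gammaNorm one_le_two hΓ)
  calc logEnergy μ ≤ _ := h3
    _ ≤ gammaNorm μ 2 ^ 2 + 24 * gammaNorm μ 2 ^ 2 := by gcongr
    _ = _ := by ring

/-! ### Assembling the cases -/

lemma Theta_of_two_lt {p : ℝ} (hp : 2 < p) (μ : Measure ℝ) (t : ℝ) :
    Theta μ p t = kernelTheta p t := if_pos hp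

lemma Theta_of_lt_two {p : ℝ} (hp : p < 2) (μ : Measure ℝ) (t : ℝ) :
    Theta μ p t = 1 / ENNReal.ofReal (1 - t) ^ (2 / p) := by
  rw [Theta, if_neg (not_lt.2 hp.le), if_neg hp.ne]

lemma lintegral_Theta_two (μ : Measure ℝ) [IsProbabilityMeasure μ] :
    ∫⁻ t, Theta μ 2 t ∂μ =
      (logEnergy μ + (∫⁻ s, 1 / ENNReal.ofReal (1 - s) ∂μ) ^ 2) ^ (1 / 2 : ℝ) := by
  simp_rw [Theta_two]
  rw [lintegral_const, measure_univ, mul_one]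

lemma lintegral_one_div_le_lintegral_Theta_two (μ : Measure ℝ) [IsProbabilityMeasure μ] :
    ∫⁻ s, 1 / ENNReal.ofReal (1 - s) ∂μ ≤ ∫⁻ t, Theta μ 2 t ∂μ := by
  rw [lintegral_Theta_two, ← rpow_half_sq (∫⁻ s, 1 / ENNReal.ofReal (1 - s) ∂μ)]
  refine ENNReal.rpow_le_rpow ?_ (by norm_num)
  rw [rpow_half_sq]
  exact le_add_left le_rfl

lemma outer_kernel_le_kernelTheta {p t : ℝ} (hp : 2 < p) (ht : t ∈ Set.Ico (0 : ℝ) 1) :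
    1 / ENNReal.ofReal (1 - t) ^ (2 / p) ≤ kernelTheta p t := by
  unfold kernelTheta
  gcongr
  have h : 2 / p - 1 ≤ 0 := by rw [sub_nonpos, div_le_one (by linarith)]; exact hp.le
  rw [← neg_neg (2 / p - 1), ENNReal.rpow_neg, ENNReal.one_le_inv]
  refine ENNReal.rpow_le_one ?_ (by linarith)
  simpa using ht.2.le

/-- In each range of `p` the integral of `Θ_p` dominates that of `(1 - t)^(-2/p)`, which already
ensures convergence and analyticity. -/
lemma gammaDefined_of_lintegral_Theta_ne_top {p : ℝ} (hp : 1 ≤ p) {μ : Measure ℝ}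
    [IsProbabilityMeasure μ] (hμ : μ (Set.Ico (0 : ℝ) 1)ᶜ = 0)
    (hfin : ∫⁻ t, Theta μ p t ∂μ ≠ ∞) : GammaDefined μ p := by
  refine gammaDefined_of_lintegral_ne_top hp hμ (ne_top_of_le_ne_top hfin ?_)
  rcases lt_trichotomy p 2 with h | rfl | h
  · simp_rw [Theta_of_lt_two h]
    exact le_rfl
  · refine le_trans (le_of_eq ?_) (lintegral_one_div_le_lintegral_Theta_two μ)
    norm_num
  · simp_rw [Theta_of_two_lt h]
    refine lintegral_mono_ae ?_
    filter_upwards [ae_mem_Ico hμ] with t ht using outer_kernel_le_kernelTheta h ht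

lemma exists_bergmanNorm_Gamma_le {p : ℝ} (hp : 1 ≤ p) :
    ∃ B : ℝ≥0∞, B ≠ ∞ ∧ (4 ≤ p → B = 1) ∧ ∀ (μ : Measure ℝ) [IsProbabilityMeasure μ],
      μ (Set.Ico (0 : ℝ) 1)ᶜ = 0 → ∫⁻ t, Theta μ p t ∂μ ≠ ∞ → ∀ f, MemBergman p f →
      bergmanNorm p (Gamma μ f) ≤ B * (∫⁻ t, Theta μ p t ∂μ) * bergmanNorm p f := by
  rcases lt_trichotomy p 2 with h | rfl | h
  · obtain ⟨B, hB, hle⟩ := exists_bergmanNorm_Gamma_le_of_lt_two hp h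
    refine ⟨B, hB, fun h4 => by linarith, fun μ _ hμ _ f hf => ?_⟩
    simp_rw [Theta_of_lt_two h]
    exact hle μ hμ f hf
  · exact ⟨18, by simp, fun h4 => by norm_num at h4, fun μ _ hμ _ f hf =>
      bergmanNorm_two_Gamma_le hμ hf⟩
  · simp_rw [Theta_of_two_lt h]
    exact exists_bergmanNorm_Gamma_le_of_two_lt h

lemma lintegral_Theta_le {p : ℝ} (hp : 1 ≤ p) (hp2 : p ≤ 2) {μ : Measure ℝ}
    [IsProbabilityMeasure μ] (hμ : μ (Set.Ico (0 : ℝ) 1)ᶜ = 0) :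
    ∫⁻ t, Theta μ p t ∂μ ≤ 8 * gammaNorm μ p := by
  by_cases hN : gammaNorm μ p = ∞
  · rw [hN, ENNReal.mul_top (by simp)]; exact le_top
  have hΓ : GammaDefined μ p := by
    by_contra h
    exact hN (by rw [gammaNorm, if_neg h])
  have hK := lintegral_outer_kernel_le hp hμ hΓ hN
  rcases hp2.lt_or_eq with h | rfl
  · simp_rw [Theta_of_lt_two h]
    refine hK.trans (mul_le_mul' (by norm_num) le_rfl)
  · have hK' : ∫⁻ s, 1 / ENNReal.ofReal (1 - s) ∂μ ≤ 6 * gammaNorm μ 2 := by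
      refine le_trans (le_of_eq ?_) hK
      norm_num
    rw [lintegral_Theta_two]
    calc _ ≤ ((8 * gammaNorm μ 2) ^ 2) ^ (1 / 2 : ℝ) := by
          refine ENNReal.rpow_le_rpow ?_ (by norm_num)
          -- The constant `8` works since `25 + 6² = 61 ≤ 8²`.
          calc _ ≤ 25 * gammaNorm μ 2 ^ 2 + (6 * gammaNorm μ 2) ^ 2 := by
                gcongr
                exact logEnergy_le hμ hΓ
            _ = 61 * gammaNorm μ 2 ^ 2 := by ring
            _ ≤ 64 * gammaNorm μ 2 ^ 2 := mul_le_mul' (by norm_num) le_rfl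
            _ = _ := by ring
      _ = _ := rpow_half_sq _

lemma exists_two_sided_bound {p : ℝ} (hp : 1 ≤ p) :
    ∃ A B : ℝ, 0 < A ∧ 0 < B ∧ (2 < p → A = 1) ∧ (4 ≤ p → B = 1) ∧
      ∀ μ : Measure ℝ, IsProbabilityMeasure μ → μ (Set.Ico (0 : ℝ) 1)ᶜ = 0 →
        ENNReal.ofReal A * ∫⁻ t, Theta μ p t ∂μ ≤ gammaNorm μ p ∧
        gammaNorm μ p ≤ ENNReal.ofReal B * ∫⁻ t, Theta μ p t ∂μ := by
  obtain ⟨B, hB, hB4, hle⟩ := exists_bergmanNorm_Gamma_le hp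
  -- Taking the maximum with `1` makes the constant positive, so that the upper bound is `∞` when
  -- the integral of `Θ_p` diverges; it leaves `B = 1` unchanged for `p ≥ 4`.
  have hB' : max B 1 ≠ ∞ := max_ne_top hB ENNReal.one_ne_top
  have hBpos : max B 1 ≠ 0 := (lt_of_lt_of_le zero_lt_one (le_max_right _ _)).ne'
  refine ⟨if 2 < p then 1 else 1 / 8, (max B 1).toReal, by split_ifs <;> norm_num,
    ENNReal.toReal_pos hBpos hB', fun h => if_pos h, fun h => by simp [hB4 h], fun μ _ hμ => ?_⟩
  constructor
  · split_ifs with h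
    · simp_rw [Theta_of_two_lt h]
      rw [ENNReal.ofReal_one, one_mul]
      exact lintegral_kernelTheta_le_gammaNorm h hμ
    · rw [one_div, ENNReal.ofReal_inv_of_pos (by norm_num), ENNReal.ofReal_ofNat]
      refine (mul_le_mul' le_rfl (lintegral_Theta_le hp (not_lt.1 h) hμ)).trans_eq ?_
      rw [← mul_assoc, ENNReal.inv_mul_cancel (by simp) (by simp), one_mul]
  · rw [ENNReal.ofReal_toReal hB']
    by_cases hfin : ∫⁻ t, Theta μ p t ∂μ = ∞
    · rw [hfin, ENNReal.mul_top hBpos]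
      exact le_top
    · rw [gammaNorm, if_pos (gammaDefined_of_lintegral_Theta_ne_top hp hμ hfin)]
      refine iSup₂_le fun f hf => iSup_le fun h1 => ?_
      refine (hle μ hμ hfin f hf).trans ?_
      rw [h1, mul_one]
      exact mul_le_mul' (le_max_left _ _) le_rfl

lemma gammaBounded_iff {p : ℝ} (hp : 1 ≤ p) {μ : Measure ℝ} [IsProbabilityMeasure μ]
    (hμ : μ (Set.Ico (0 : ℝ) 1)ᶜ = 0) :
    GammaBounded μ p ↔ ∫⁻ t, Theta μ p t ∂μ < ∞ := by
  constructor
  · rintro ⟨hΓ, -, C, hC⟩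
    obtain ⟨A, B, hA, -, -, -, h⟩ := exists_two_sided_bound hp
    have h1 : gammaNorm μ p ≤ ENNReal.ofReal C := by
      rw [gammaNorm, if_pos hΓ]
      refine iSup₂_le fun f hf => iSup_le fun hf1 => ?_
      simpa [hf1] using hC f hf
    have h2 := ((h μ inferInstance hμ).1.trans h1).trans_lt ENNReal.ofReal_lt_top
    exact ENNReal.lt_top_of_mul_ne_top_right h2.ne (by simpa using hA)
  · intro hfin
    obtain ⟨B, hB, -, hle⟩ := exists_bergmanNorm_Gamma_le hp
    have hΓ := gammaDefined_of_lintegral_Theta_ne_top hp hμ hfin.ne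
    have hBfin := ENNReal.mul_lt_top hB.lt_top hfin
    refine ⟨hΓ, fun f hf => ⟨(hΓ f hf).2, ?_⟩, (B * ∫⁻ t, Theta μ p t ∂μ).toReal, fun f hf => ?_⟩
    · exact (hle μ hμ hfin.ne f hf).trans_lt (ENNReal.mul_lt_top hBfin hf.2)
    · rw [ENNReal.ofReal_toReal hBfin.ne]
      exact hle μ hμ hfin.ne f hf

end HilbertBergman

end

theorem theorem1 (p : ℝ) (hp : 1 ≤ p) :
    (∀ μ : Measure ℝ, IsProbabilityMeasure μ → μ (Set.Ico (0 : ℝ) 1)ᶜ = 0 →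
      (HilbertBergman.GammaBounded μ p ↔ ∫⁻ t, HilbertBergman.Theta μ p t ∂μ < ∞)) ∧
    (∃ A B : ℝ, 0 < A ∧ 0 < B ∧ (2 < p → A = 1) ∧ (4 ≤ p → B = 1) ∧
      ∀ μ : Measure ℝ, IsProbabilityMeasure μ → μ (Set.Ico (0 : ℝ) 1)ᶜ = 0 →
        ENNReal.ofReal A * ∫⁻ t, HilbertBergman.Theta μ p t ∂μ ≤ HilbertBergman.gammaNorm μ p ∧
        HilbertBergman.gammaNorm μ p ≤ ENNReal.ofReal B * ∫⁻ t, HilbertBergman.Theta μ p t ∂μ) ∧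
    (4 ≤ p → ∀ μ : Measure ℝ, IsProbabilityMeasure μ → μ (Set.Ico (0 : ℝ) 1)ᶜ = 0 →
      HilbertBergman.gammaNorm μ p = ∫⁻ t, HilbertBergman.kernelTheta p t ∂μ) := by
  refine ⟨fun μ _ hμ => HilbertBergman.gammaBounded_iff hp hμ,
    HilbertBergman.exists_two_sided_bound hp, fun h4 μ hμ1 hμ => ?_⟩
  obtain ⟨A, B, -, -, hA, hB, h⟩ := HilbertBergman.exists_two_sided_bound hp
  have h2 : 2 < p := by linarith
  have h' := h μ hμ1 hμ
  simp_rw [hA h2, hB h4, HilbertBergman.Theta_of_two_lt h2, ENNReal.ofReal_one, one_mul] at h'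
  exact le_antisymm h'.2 h'.1
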